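/- Let $X_1,X_2,\dots$ be i.i.d. real random variables with distribution function $F$, and let $X_{1,n}\le\dots\le X_{n,n}$ denote the order statistics of $X_1,\dots,X_n$. Suppose that $$1-F(x)=\exp(-H(x))\ (x\in\mathbb R),\qquad H^{-1}(x):=\inf\{t:\ H(t)\ge x\}=x^{\theta}\ell(x)\ (x>0),$$ where $\theta>0$ and $\ell$ is slowly varying at infinity, i.e. $\ell$ is positive near infinity and $\ell(cx)/\ell(x)\to1$ as $x\to\infty$ for every $c>0$. Suppose that there are $\rho<0$ and a function $b$ with $b(x)\to0$ and $x|b(x)|\to\infty$ as $x\to\infty$, such that for all $\varepsilon>0$ and $1<A<\infty$, $$\sup_{1<c\le A}\left|\frac{\log(\ell(cx)/\ell(x))}{b(x)K_\rho(c)}-1\right|\le\varepsilon\quad\text{for all sufficiently large }x,\qquad K_\rho(c)=\int_1^c t^{\rho-1}\,dt.$$ Let $(k_n)$ be a sequence of positive integers with $k_n\to\infty$ and $k_n/n\to0$, such that $\sqrt{k_n}\,b(\log(n/k_n))\to\lambda$ for some $\lambda\in\mathbb R$; if $\lambda=0$, suppose also that $\log k_n/\log n\to0$. For $1\le j\le k_n<n$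 put $$Z_j=j\log(n/j)\,\bigl(\log X_{n-j+1,n}-\log X_{n-j,n}\bigr),\qquad \check\theta_n(k_n)=\frac1{k_n}\sum_{j=1}^{k_n}Z_j$$ (these are well defined with probability tending to $1$). Then, as $n\to\infty$, $$\sqrt{k_n}\left(\check\theta_n(k_n)-\theta-b(\log(n/k_n))\,\frac1{k_n}\sum_{j=1}^{k_n}\left(\frac{\log(n/j)}{\log(n/k_n)}\right)^{\rho}\right)\xrightarrow{\ d\ }\mathcal N(0,\theta^2).$$ -/

import Mathlib

open MeasureTheory ProbabilityTheory Filter Topology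

noncomputable section

namespace WeibullTail

/-- `H = -log (1 - F)`, where `F` is the distribution function of `μ`. -/
def cumHazard (μ : Measure ℝ) (x : ℝ) : ℝ := -Real.log (1 - cdf μ x)

/-- The generalized inverse `H⁻¹(x) = inf {t : H(t) ≥ x}`. -/
def cumHazardInv (μ : Measure ℝ) (x : ℝ) : ℝ := sInf {t : ℝ | x ≤ cumHazard μ t}

/-- `ℓ` is slowly varying at infinity: it is positive near infinity and
`ℓ (c x) / ℓ x → 1` as `x → ∞`, for every `c > 0`. -/
def IsSlowlyVarying (ℓ : ℝ → ℝ) : Prop :=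
  (∀ᶠ x in atTop, 0 < ℓ x) ∧
    ∀ c : ℝ, 0 < c → Tendsto (fun x => ℓ (c * x) / ℓ x) atTop (𝓝 1)

/-- `μ` has a Weibull tail with coefficient `θ > 0` and slowly varying part `ℓ`:
`1 - F(x) = exp (-H(x))` for all real `x`, and `H⁻¹(x) = x ^ θ ℓ(x)` for `x > 0`. -/
structure IsWeibullTail (μ : Measure ℝ) (θ : ℝ) (ℓ : ℝ → ℝ) : Prop where
  coeff_pos : 0 < θ
  tail : ∀ x : ℝ, 1 - cdf μ x = Real.exp (-cumHazard μ x)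
  slowlyVarying : IsSlowlyVarying ℓ
  inverse : ∀ x : ℝ, 0 < x → cumHazardInv μ x = x ^ θ * ℓ x

/-- `K_ρ(c) = ∫_1^c t ^ (ρ - 1) dt`. -/
def K (ρ c : ℝ) : ℝ := ∫ t in (1 : ℝ)..c, t ^ (ρ - 1)

/-- The second-order condition `R_ℓ(b, ρ)`. The quotient has the form `0 / 0` at `c = 1`,
so the supremum is taken over `1 < c ≤ A`. -/
structure SecondOrder (ℓ b : ℝ → ℝ) (ρ : ℝ) : Prop where
  rho_neg : ρ < 0
  tendsto_zero : Tendsto b atTop (𝓝 0)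
  uniform : ∀ ε : ℝ, 0 < ε → ∀ A : ℝ, 1 < A → ∀ᶠ x in atTop, ∀ c ∈ Set.Ioc (1 : ℝ) A,
    |Real.log (ℓ (c * x) / ℓ x) / (b x * K ρ c) - 1| ≤ ε

/-- The order statistic `x_{i,n}`, that is, the `i`-th smallest of the `n` values of `x`, for
`1 ≤ i ≤ n` (and `0` for other `i`). -/
def orderStat {n : ℕ} (x : Fin n → ℝ) (i : ℕ) : ℝ :=
  if h : 1 ≤ i ∧ i ≤ n then x (Tuple.sort x ⟨i - 1, by omega⟩) else 0

/-- The normalized log-spacing `Z_j = j log (n / j) (log x_{n-j+1,n} - log x_{n-j,n})`. -/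
def logSpacing {n : ℕ} (x : Fin n → ℝ) (j : ℕ) : ℝ :=
  j * Real.log ((n : ℝ) / j) *
    (Real.log (orderStat x (n - j + 1)) - Real.log (orderStat x (n - j)))

/-- The estimator `k⁻¹ ∑_{j=1}^k Z_j`. -/
def thetaCheck {n : ℕ} (x : Fin n → ℝ) (k : ℕ) : ℝ :=
  (1 / (k : ℝ)) * ∑ j ∈ Finset.Icc 1 k, logSpacing x j

/-- The bias term `b(log (n / k)) k⁻¹ ∑_{j=1}^k (log (n / j) / log (n / k)) ^ ρ`. -/
def biasTerm (b : ℝ → ℝ) (ρ : ℝ) (n k : ℕ) : ℝ :=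
  b (Real.log ((n : ℝ) / k)) *
    ((1 / (k : ℝ)) * ∑ j ∈ Finset.Icc 1 k,
      (Real.log ((n : ℝ) / j) / Real.log ((n : ℝ) / k)) ^ ρ)

end WeibullTail

end

/-!
The estimator is a symmetric function of the sample, so only the law of the order statistics
matters. As `μ` is the image of the standard exponential law under `H⁻¹`
(`map_cumHazardInv_expMeasure`), the sample may be replaced by `H⁻¹(E_1), …, H⁻¹(E_n)` with
exponential `E_i`, and by Rényi's representation (`lintegral_pi_expMeasure_eq_renyi`) the `E_i` in
decreasing order may be replaced by `x_j = ∑_{j ≤ i < n} f_i / (i + 1)` with `f_i` independent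
standard exponential. Rényi's representation is a linear change of variables with Jacobian `1 / n!`
from the positive orthant onto the decreasing positive vectors, followed by summation over all
orderings. After this reduction (`map_symmetric_statistic_eq`) the spacing
`x_{j-1} - x_j` is `f_{j-1} / j`, and

`Z_j = j log (n / j) (θ (log x_{j-1} - log x_j) + (log ℓ(x_{j-1}) - log ℓ(x_j)))`.

Put `L = log (n / k_n)`. As `√k_n b(L)` converges and `L |b(L)| → ∞`, necessarily `√k_n / L → 0`
(`tendsto_sqrt_div_log`). Therefore `log n / L → 1`, all `x_j` and all `log (n / j)` with `j ≤ k_n`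
are `L (1 + o(1))`, and crude bounds suffice:

* the first part of `Z_j` is `θ f_{j-1}` up to
  `O((f_{j-1}² + (x_j - log (n / j))²) / L)`; as `E (x_j - log (n / j))² ≤ 3`, these errors
  add up to `O(k_n / L) = o(√k_n)` in mean;
* the second-order condition makes `b(x) / b(L) → 1` when `x / L → 1`, so that the second part of
  `Z_j` is `b(L) f_{j-1} (1 + o(1))` (`SecondOrder.abs_log_sub_linear_le`); its normalized sum
  cancels the bias term, every summand of which is `b(L) (1 + o(1))`, because `√k_n b(L)` is bounded
  and the mean of the `f_i` tends to `1`.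

What is left is `θ (√k_n)⁻¹ ∑_{i < k_n} (f_i - 1)`, to which the central limit theorem applies, and
Slutsky's theorem concludes.
-/

namespace WeibullTail

/-! ### Order statistics -/

theorem orderStat_comp_perm {n : ℕ} (x : Fin n → ℝ) (σ : Equiv.Perm (Fin n)) (i : ℕ) :
    orderStat (x ∘ σ) i = orderStat x i := by
  unfold orderStat
  split_ifs with h
  · exact congrFun (Tuple.comp_perm_comp_sort_eq_comp_sort (f := x) (σ := σ)) _
  · rfl

theorem orderStat_of_antitone {n : ℕ} {x : Fin n → ℝ} (hx : Antitone x) {j : ℕ} (hj : j < n) :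
    orderStat x (n - j) = x ⟨j, hj⟩ := by
  have hm : Monotone (x ∘ (Fin.revPerm : Equiv.Perm (Fin n))) :=
    fun a b hab => hx (Fin.rev_le_rev.2 hab)
  have h := Tuple.comp_sort_eq_comp_iff_monotone.2 hm
  have h1 : 1 ≤ n - j ∧ n - j ≤ n := by omega
  rw [orderStat, dif_pos h1]
  refine (congrFun h.symm ⟨n - j - 1, by omega⟩).trans ?_
  simp only [Function.comp_apply, Fin.revPerm_apply]
  congr 1
  ext
  simp only [Fin.val_rev]
  omega

theorem measurable_orderStat {n : ℕ} (i : ℕ) :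
    Measurable (fun x : Fin n → ℝ => orderStat x i) := by
  unfold orderStat
  split_ifs with h
  · refine measurable_of_Iic fun a => ?_
    -- The `i`-th smallest value is at most `a` iff at least `i` of the values are.
    have : (fun x : Fin n → ℝ => x (Tuple.sort x ⟨i - 1, by omega⟩)) ⁻¹' Set.Iic a =
        {x | i - 1 < ∑ j, if x j ≤ a then 1 else 0} := by
      ext x
      have hm := Tuple.monotone_sort x
      have h1 := Tuple.lt_card_le_iff_apply_le_of_monotone (j := ⟨i - 1, by omega⟩) (a := a) hm
      simp only [Set.mem_preimage, Set.mem_Iic, Set.mem_ofPred_eq]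
      rw [Function.comp_apply] at h1
      rw [← h1, Finset.card_filter]
      simp only [Function.comp_apply]
      rw [Equiv.sum_comp (Tuple.sort x) (fun j => if x j ≤ a then 1 else 0)]
    rw [this]
    refine measurableSet_lt measurable_const ?_
    refine Finset.measurable_fun_sum _ fun j _ => Measurable.ite ?_ measurable_const measurable_const
    exact measurableSet_le (measurable_pi_apply j) measurable_const
  · exact measurable_const

/-! ### The Rényi representation of exponential order statistics -/

theorem lintegral_fin_prod_eq_prod (n : ℕ) (g : Fin n → ℝ → ENNReal)
    (hg : ∀ i, Measurable (g i)) :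
    ∫⁻ y : Fin n → ℝ, ∏ i, g i (y i) = ∏ i, ∫⁻ t, g i t := by
  induction n with
  | zero => simp [volume_pi]
  | succ n ih =>
    have e := (volume_preserving_piFinSuccAbove (fun _ : Fin (n + 1) => ℝ) 0).symm
    rw [← e.lintegral_comp (by fun_prop)]
    simp only [Fin.prod_univ_succ]
    rw [← ih _ fun i => hg i.succ, ← lintegral_prod_mul (hg 0).aemeasurable
      (Finset.measurable_fun_prod _ fun i _ => (hg i.succ).comp (measurable_pi_apply i)).aemeasurable]
    rfl

theorem pi_expMeasure_eq (n : ℕ) :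
    Measure.pi (fun _ : Fin n => expMeasure 1) =
      volume.withDensity (fun y : Fin n → ℝ => ∏ i, exponentialPDF 1 (y i)) := by
  have hm : Measurable (exponentialPDF 1) :=
    (measurable_exponentialPDFReal 1).ennreal_ofReal
  have := isProbabilityMeasure_expMeasure (r := 1) one_pos
  refine Measure.pi_eq fun s hs => ?_
  rw [withDensity_apply _ (MeasurableSet.univ_pi hs), ← lintegral_indicator (MeasurableSet.univ_pi hs)]
  have : ∀ y : Fin n → ℝ, (Set.univ.pi s).indicator (fun y => ∏ i, exponentialPDF 1 (y i)) y =
      ∏ i, (s i).indicator (exponentialPDF 1) (y i) := by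
    intro y
    by_cases hy : y ∈ Set.univ.pi s
    · rw [Set.indicator_of_mem hy]
      exact Finset.prod_congr rfl fun i _ => (Set.indicator_of_mem (hy i trivial) _).symm
    · rw [Set.indicator_of_notMem hy]
      simp only [Set.mem_univ_pi, not_forall] at hy
      obtain ⟨i, hi⟩ := hy
      exact (Finset.prod_eq_zero (Finset.mem_univ i) (Set.indicator_of_notMem hi _)).symm
  simp_rw [this]
  rw [lintegral_fin_prod_eq_prod n (fun i => (s i).indicator (exponentialPDF 1))
    fun i => hm.indicator (hs i)]
  refine Finset.prod_congr rfl fun i _ => ?_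
  rw [lintegral_indicator (hs i), ← withDensity_apply _ (hs i)]
  rfl

/-- The matrix of the Rényi map `e ↦ (∑_{i ≥ j} e i / (i + 1))_j`, which turns the normalized
spacings of a sample into its values in decreasing order. -/
noncomputable def renyiMatrix (n : ℕ) : Matrix (Fin n) (Fin n) ℝ :=
  Matrix.of fun j i => if j ≤ i then 1 / ((i : ℝ) + 1) else 0

theorem renyiMatrix_mulVec {n : ℕ} (e : Fin n → ℝ) (j : Fin n) :
    (renyiMatrix n).mulVec e j = ∑ i, if j ≤ i then e i / ((i : ℝ) + 1) else 0 := by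
  simp only [renyiMatrix, Matrix.mulVec, dotProduct, Matrix.of_apply]
  refine Finset.sum_congr rfl fun i _ => ?_
  split_ifs <;> ring

theorem det_renyiMatrix (n : ℕ) : (renyiMatrix n).det = 1 / (n.factorial : ℝ) := by
  have ht : (renyiMatrix n).BlockTriangular id := by
    intro i j hij
    simp only [id] at hij
    simp [renyiMatrix, not_le.2 hij]
  rw [Matrix.det_of_isUpperTriangular ht]
  simp only [renyiMatrix, Matrix.of_apply, le_refl, if_true]
  rw [Fin.prod_univ_eq_prod_range (fun i => 1 / ((i : ℝ) + 1)), Finset.prod_div_distrib]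
  rw [← Finset.prod_range_add_one_eq_factorial]
  push_cast
  simp

theorem sum_renyiMatrix_mulVec {n : ℕ} (e : Fin n → ℝ) :
    ∑ j, (renyiMatrix n).mulVec e j = ∑ i, e i := by
  simp only [renyiMatrix_mulVec]
  rw [Finset.sum_comm]
  refine Finset.sum_congr rfl fun i _ => ?_
  rw [← Finset.sum_filter, Finset.sum_const, nsmul_eq_mul]
  have : (Finset.univ.filter fun j : Fin n => j ≤ i) = Finset.Iic i := by ext; simp
  rw [this, Fin.card_Iic]
  push_cast
  field_simp

theorem renyiMatrix_mulVec_sub {n : ℕ} (e : Fin n → ℝ) (i j : Fin n) (h : (j : ℕ) = i + 1) :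
    (renyiMatrix n).mulVec e i = (renyiMatrix n).mulVec e j + e i / ((i : ℝ) + 1) := by
  simp only [renyiMatrix_mulVec]
  rw [← sub_eq_iff_eq_add', ← Finset.sum_sub_distrib, Finset.sum_eq_single i]
  · have : ¬ j ≤ i := by rw [Fin.le_def]; omega
    simp [this]
  · intro a _ ha
    have : i ≤ a ↔ j ≤ a := by
      have : (a : ℕ) ≠ i := fun h => ha (Fin.ext h)
      rw [Fin.le_def, Fin.le_def]; omega
    simp [this]
  · simp

theorem renyiMatrix_mulVec_last {n : ℕ} (e : Fin n → ℝ) (i : Fin n) (h : (i : ℕ) + 1 = n) :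
    (renyiMatrix n).mulVec e i = e i / ((i : ℝ) + 1) := by
  simp only [renyiMatrix_mulVec]
  rw [Finset.sum_eq_single i]
  · simp
  · intro a _ ha
    have : ¬ i ≤ a := by
      have : (a : ℕ) ≠ i := fun h => ha (Fin.ext h)
      rw [Fin.le_def]; omega
    simp [this]
  · simp

/-- The Rényi map identifies the nonnegative orthant with its decreasing vectors. -/
theorem forall_nonneg_iff_renyi {n : ℕ} (e : Fin n → ℝ) :
    (∀ i, 0 ≤ e i) ↔
      Antitone ((renyiMatrix n).mulVec e) ∧ ∀ i, 0 ≤ (renyiMatrix n).mulVec e i := by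
  constructor
  · intro h
    have hterm : ∀ i : Fin n, 0 ≤ e i / ((i : ℝ) + 1) := fun i => by have := h i; positivity
    constructor
    · intro a b hab
      simp only [renyiMatrix_mulVec]
      refine Finset.sum_le_sum fun i _ => ?_
      split_ifs with h1 h2
      · exact le_rfl
      · exact absurd (hab.trans h1) h2
      · exact hterm i
      · exact le_rfl
    · intro i
      rw [renyiMatrix_mulVec]
      exact Finset.sum_nonneg fun j _ => by split_ifs; exacts [hterm j, le_rfl]
  · rintro ⟨ha, h0⟩ i
    have hi : (0 : ℝ) < (i : ℝ) + 1 := by positivity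
    rcases Nat.lt_or_ge (i + 1) n with h | h
    · have h1 := renyiMatrix_mulVec_sub e i ⟨i + 1, h⟩ rfl
      have h2 := ha (show i ≤ ⟨i + 1, h⟩ by rw [Fin.le_def]; simp)
      have : 0 ≤ e i / ((i : ℝ) + 1) := by linarith
      simpa [div_mul_cancel₀ _ hi.ne'] using mul_nonneg this hi.le
    · have h1 := renyiMatrix_mulVec_last e i (by omega)
      have := h0 i
      rw [h1] at this
      simpa [div_mul_cancel₀ _ hi.ne'] using mul_nonneg this hi.le

theorem prod_exponentialPDF_of_nonneg {n : ℕ} {y : Fin n → ℝ} (hy : ∀ i, 0 ≤ y i) :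
    ∏ i, exponentialPDF 1 (y i) = ENNReal.ofReal (Real.exp (-∑ i, y i)) := by
  simp_rw [fun i => exponentialPDF_of_nonneg (r := 1) (hy i)]
  rw [← ENNReal.ofReal_prod_of_nonneg (fun i _ => by positivity)]
  simp [← Real.exp_sum]

/-- The density of an exponential sample at `e` is its density at the image of `e` under the Rényi
map, cut down to decreasing vectors; the exponents agree by `sum_renyiMatrix_mulVec`. -/
theorem prod_exponentialPDF_renyi {n : ℕ} (e : Fin n → ℝ) :
    ∏ i, exponentialPDF 1 (e i) =
      {y : Fin n → ℝ | Antitone y}.indicator (fun y => ∏ i, exponentialPDF 1 (y i))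
        ((renyiMatrix n).mulVec e) := by
  by_cases h : ∀ i, 0 ≤ e i
  · obtain ⟨h1, h2⟩ := (forall_nonneg_iff_renyi e).1 h
    rw [Set.indicator_of_mem (show _ ∈ {y : Fin n → ℝ | Antitone y} from h1),
      prod_exponentialPDF_of_nonneg h, prod_exponentialPDF_of_nonneg h2, sum_renyiMatrix_mulVec]
  · have h' := h
    rw [forall_nonneg_iff_renyi] at h
    push Not at h'
    obtain ⟨i, hi⟩ := h'
    rw [Finset.prod_eq_zero (Finset.mem_univ i) (exponentialPDF_of_neg hi)]
    by_cases ha : Antitone ((renyiMatrix n).mulVec e)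
    · have : ∃ i, (renyiMatrix n).mulVec e i < 0 := by
        by_contra hc
        push Not at hc
        exact h ⟨ha, hc⟩
      obtain ⟨j, hj⟩ := this
      rw [Set.indicator_of_mem (show _ ∈ {y : Fin n → ℝ | Antitone y} from ha)]
      exact (Finset.prod_eq_zero (Finset.mem_univ j) (exponentialPDF_of_neg hj)).symm
    · exact (Set.indicator_of_notMem ha _).symm

theorem measurableSet_antitone (n : ℕ) : MeasurableSet {y : Fin n → ℝ | Antitone y} := by
  have : {y : Fin n → ℝ | Antitone y} = ⋂ i, ⋂ j, ⋂ (_ : i ≤ j), {y | y j ≤ y i} := by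
    ext y
    simp [Antitone]
  rw [this]
  exact MeasurableSet.iInter fun i => MeasurableSet.iInter fun j => MeasurableSet.iInter fun _ =>
    measurableSet_le (measurable_pi_apply j) (measurable_pi_apply i)

/-- Change of variables along the Rényi map, whose Jacobian is `1 / n!`. -/
theorem lintegral_renyi_eq_factorial_mul {n : ℕ} {φ : (Fin n → ℝ) → ENNReal} (hφ : Measurable φ) :
    ∫⁻ e, φ ((renyiMatrix n).mulVec e) ∂Measure.pi (fun _ : Fin n => expMeasure 1) =
      n.factorial * ∫⁻ y in {y : Fin n → ℝ | Antitone y}, φ y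
        ∂Measure.pi (fun _ : Fin n => expMeasure 1) := by
  have hm : Measurable (exponentialPDF 1) :=
    (measurable_exponentialPDFReal 1).ennreal_ofReal
  have hp : Measurable fun y : Fin n → ℝ => ∏ i, exponentialPDF 1 (y i) := by fun_prop
  have hM : Measurable (Matrix.toLin' (renyiMatrix n)) :=
    (LinearMap.continuous_of_finiteDimensional _).measurable
  have hdet : (renyiMatrix n).det ≠ 0 := by rw [det_renyiMatrix]; positivity
  have hmap := Real.map_matrix_volume_pi_eq_smul_volume_pi hdet
  rw [det_renyiMatrix, one_div, inv_inv, abs_of_nonneg (by positivity),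
    ENNReal.ofReal_natCast] at hmap
  rw [pi_expMeasure_eq, ← lintegral_indicator (measurableSet_antitone n),
    lintegral_withDensity_eq_lintegral_mul _ hp (g := fun e => φ ((renyiMatrix n).mulVec e))
      (hφ.comp hM),
    lintegral_withDensity_eq_lintegral_mul _ hp (hφ.indicator (measurableSet_antitone n))]
  have h1 : ∀ e : Fin n → ℝ, ((fun y : Fin n → ℝ => ∏ i, exponentialPDF 1 (y i)) *
      fun e => φ ((renyiMatrix n).mulVec e)) e =
      ((fun y : Fin n → ℝ => ∏ i, exponentialPDF 1 (y i)) *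
        {y : Fin n → ℝ | Antitone y}.indicator φ) (Matrix.toLin' (renyiMatrix n) e) := by
    intro e
    simp only [Pi.mul_apply, Matrix.toLin'_apply]
    rw [prod_exponentialPDF_renyi]
    simp only [Set.indicator_apply]
    split_ifs <;> simp
  change ∫⁻ e, ((fun y : Fin n → ℝ => ∏ i, exponentialPDF 1 (y i)) *
      fun e => φ ((renyiMatrix n).mulVec e)) e = _
  rw [lintegral_congr h1, ← lintegral_map (f := (fun y : Fin n → ℝ => ∏ i, exponentialPDF 1 (y i)) *
        {y : Fin n → ℝ | Antitone y}.indicator φ) (hp.mul (hφ.indicator (measurableSet_antitone n)))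
        hM, hmap, lintegral_smul_measure]
  rfl

theorem ae_injective_pi_expMeasure (n : ℕ) :
    ∀ᵐ y ∂Measure.pi (fun _ : Fin n => expMeasure 1), Function.Injective y := by
  rw [pi_expMeasure_eq]
  refine (withDensity_absolutelyContinuous _ _).ae_le ?_
  have : ∀ᵐ y : Fin n → ℝ, ∀ i j : Fin n, i ≠ j → y i ≠ y j := by
    rw [ae_all_iff]; intro i
    rw [ae_all_iff]; intro j
    by_cases hij : i = j
    · simp [hij]
    let S : Submodule ℝ (Fin n → ℝ) :=
      LinearMap.ker (LinearMap.proj (R := ℝ) (φ := fun _ : Fin n => ℝ) i - LinearMap.proj j)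
    have hS : S ≠ ⊤ := by
      intro h
      have : Pi.single i (1 : ℝ) ∈ S := h ▸ Submodule.mem_top
      simp [S, LinearMap.mem_ker, Ne.symm hij] at this
    have := Measure.addHaar_submodule volume S hS
    rw [measure_eq_zero_iff_ae_notMem] at this
    filter_upwards [this] with y hy _ h
    exact hy (by simp [S, LinearMap.mem_ker, h])
  filter_upwards [this] with y hy i j h
  by_contra hc
  exact hy i j hc h

open Classical in
/-- Exactly one rearrangement of a vector with distinct entries is decreasing. -/
theorem sum_indicator_antitone_comp_perm {n : ℕ} {y : Fin n → ℝ} (hy : Function.Injective y) :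
    ∑ σ : Equiv.Perm (Fin n), (if Antitone (y ∘ σ) then (1 : ENNReal) else 0) = 1 := by
  have hs : Antitone (y ∘ (Fin.revPerm.trans (Tuple.sort y) : Equiv.Perm (Fin n))) :=
    fun a b hab => Tuple.monotone_sort y (Fin.rev_le_rev.2 hab)
  rw [Finset.sum_eq_single (Fin.revPerm.trans (Tuple.sort y) : Equiv.Perm (Fin n))]
  · exact if_pos hs
  · intro τ _ hτ
    refine if_neg fun h => hτ ?_
    have := Tuple.unique_antitone h hs
    ext i : 1
    exact hy (congrFun this i)
  · simp

/-- **Rényi representation.** A symmetric functional of an exponential sample has the same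
distribution as the functional of the partial sums of normalized exponentials. -/
theorem lintegral_pi_expMeasure_eq_renyi {n : ℕ} {φ : (Fin n → ℝ) → ENNReal} (hφ : Measurable φ)
    (hsymm : ∀ (y : Fin n → ℝ) (σ : Equiv.Perm (Fin n)), φ (y ∘ σ) = φ y) :
    ∫⁻ e, φ e ∂Measure.pi (fun _ : Fin n => expMeasure 1) =
      ∫⁻ e, φ ((renyiMatrix n).mulVec e) ∂Measure.pi (fun _ : Fin n => expMeasure 1) := by
  classical
  have := isProbabilityMeasure_expMeasure (r := 1) one_pos
  set π := Measure.pi (fun _ : Fin n => expMeasure 1) with hπ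
  rw [lintegral_renyi_eq_factorial_mul hφ]
  have hA := measurableSet_antitone n
  have hmp : ∀ σ : Equiv.Perm (Fin n), MeasurePreserving (fun y : Fin n → ℝ => y ∘ σ) π π := by
    intro σ
    have := measurePreserving_piCongrLeft (fun _ : Fin n => expMeasure 1) σ.symm
    convert this using 1
    ext y i
    have := Equiv.piCongrLeft_apply_apply (fun _ => ℝ) σ.symm y (σ i)
    simpa [MeasurableEquiv.coe_piCongrLeft] using this.symm
  have h1 : ∀ σ : Equiv.Perm (Fin n),
      ∫⁻ y in {y : Fin n → ℝ | Antitone y}, φ y ∂π =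
        ∫⁻ y, φ y * (if Antitone (y ∘ σ) then 1 else 0) ∂π := by
    intro σ
    rw [← lintegral_indicator hA, ← (hmp σ).lintegral_comp (hφ.indicator hA)]
    refine lintegral_congr fun y => ?_
    simp only [Set.indicator_apply, Set.mem_ofPred_eq, hsymm]
    split_ifs <;> simp
  -- By symmetry each of the `n!` orderings contributes the integral over decreasing vectors.
  have h2 : (n.factorial : ENNReal) * ∫⁻ y in {y : Fin n → ℝ | Antitone y}, φ y ∂π =
      ∑ σ : Equiv.Perm (Fin n), ∫⁻ y, φ y * (if Antitone (y ∘ σ) then 1 else 0) ∂π := by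
    rw [← Finset.sum_congr rfl fun σ _ => h1 σ, Finset.sum_const, nsmul_eq_mul,
      Finset.card_univ, Fintype.card_perm, Fintype.card_fin]
  rw [h2, ← lintegral_finsetSum]
  · refine lintegral_congr_ae ?_
    filter_upwards [ae_injective_pi_expMeasure n] with y hy
    rw [← Finset.mul_sum, sum_indicator_antitone_comp_perm hy, mul_one]
  · intro σ _
    refine hφ.mul (Measurable.ite ?_ measurable_const measurable_const)
    exact (hmp σ).measurable hA

/-! ### Moments of exponential variables -/

theorem expMeasure_one_eq : expMeasure 1 =
    (volume.restrict (Set.Ioi 0)).withDensity (fun x => ENNReal.ofReal (Real.exp (-x))) := by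
  rw [Measure.restrict_congr_set Ioi_ae_eq_Ici, ← withDensity_indicator measurableSet_Ici]
  change volume.withDensity (exponentialPDF 1) = _
  congr 1
  ext x
  by_cases hx : 0 ≤ x
  · rw [Set.indicator_of_mem (Set.mem_Ici.2 hx), exponentialPDF_of_nonneg hx]
    simp
  · rw [Set.indicator_of_notMem (by simpa using hx), exponentialPDF_of_neg (not_le.1 hx)]

theorem ae_pos_expMeasure : ∀ᵐ x ∂expMeasure 1, 0 < x := by
  rw [expMeasure_one_eq]
  refine (withDensity_absolutelyContinuous _ _).ae_le ?_
  filter_upwards [ae_restrict_mem measurableSet_Ioi] with x hx using hx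

theorem integrable_pow_expMeasure (m : ℕ) : Integrable (fun x : ℝ => x ^ m) (expMeasure 1) := by
  rw [expMeasure_one_eq, integrable_withDensity_iff_integrable_smul' (by fun_prop) (by simp)]
  have h := Real.GammaIntegral_convergent (s := (m : ℝ) + 1) (by positivity)
  refine h.congr_fun (fun x hx => ?_) measurableSet_Ioi
  simp [ENNReal.toReal_ofReal (Real.exp_pos _).le]

theorem integral_pow_expMeasure (m : ℕ) : ∫ x, x ^ m ∂expMeasure 1 = m.factorial := by
  rw [expMeasure_one_eq, integral_withDensity_eq_integral_toReal_smul (by fun_prop) (by simp),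
    ← Real.Gamma_nat_eq_factorial, Real.Gamma_eq_integral (by positivity)]
  refine setIntegral_congr_fun measurableSet_Ioi fun x hx => ?_
  simp [ENNReal.toReal_ofReal (Real.exp_pos _).le]

section Exponential

variable {Ω : Type*} [MeasurableSpace Ω] {Q : Measure Ω}

theorem integrable_pow_of_hasLaw_exp {Y : Ω → ℝ} (h : HasLaw Y (expMeasure 1) Q) (m : ℕ) :
    Integrable (fun ω => Y ω ^ m) Q := by
  have := integrable_pow_expMeasure m
  rw [← h.map_eq] at this
  exact this.comp_aemeasurable h.aemeasurable

theorem integral_pow_of_hasLaw_exp {Y : Ω → ℝ} (h : HasLaw Y (expMeasure 1) Q) (m : ℕ) :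
    ∫ ω, Y ω ^ m ∂Q = m.factorial := by
  rw [← integral_pow_expMeasure]
  exact h.integral_comp (f := fun x => x ^ m) (by fun_prop)

theorem memLp_two_of_hasLaw_exp {Y : Ω → ℝ} (h : HasLaw Y (expMeasure 1) Q) : MemLp Y 2 Q :=
  (memLp_two_iff_integrable_sq h.aemeasurable.aestronglyMeasurable).2
    (integrable_pow_of_hasLaw_exp h 2)

theorem integral_of_hasLaw_exp {Y : Ω → ℝ} (h : HasLaw Y (expMeasure 1) Q) :
    ∫ ω, Y ω ∂Q = 1 := by
  simpa using integral_pow_of_hasLaw_exp h 1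

theorem variance_of_hasLaw_exp [IsProbabilityMeasure Q] {Y : Ω → ℝ}
    (h : HasLaw Y (expMeasure 1) Q) : Var[Y; Q] = 1 := by
  rw [variance_eq_sub (memLp_two_of_hasLaw_exp h), integral_of_hasLaw_exp h]
  have := integral_pow_of_hasLaw_exp h 2
  simp only [Pi.pow_apply, this]
  norm_num [Nat.factorial]

/-- `E (Y - c)² = Var Y + (E Y - c)²`. -/
theorem integral_sub_sq [IsProbabilityMeasure Q] {Y : Ω → ℝ} (h : MemLp Y 2 Q) (c : ℝ) :
    ∫ ω, (Y ω - c) ^ 2 ∂Q = Var[Y; Q] + (∫ ω, Y ω ∂Q - c) ^ 2 := by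
  have hi : Integrable Y Q := h.integrable (by norm_num)
  have h2 : Integrable (fun ω => Y ω ^ 2) Q := h.integrable_sq
  rw [variance_eq_sub h]
  have : ∀ ω, (Y ω - c) ^ 2 = Y ω ^ 2 - 2 * c * Y ω + c ^ 2 := fun ω => by ring
  simp_rw [this]
  rw [integral_add (f := fun ω => Y ω ^ 2 - 2 * c * Y ω) (g := fun _ => c ^ 2)
    (h2.sub (hi.const_mul _)) (integrable_const _), integral_sub h2 (hi.const_mul _),
    integral_const_mul, integral_const]
  simp only [Pi.pow_apply, probReal_univ, smul_eq_mul]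
  ring

/-- The `j`-th largest of `n` exponential variables (counted from `0`) in terms of the
normalized spacings `f`. -/
noncomputable def renyiSum (n : ℕ) (f : ℕ → ℝ) (j : ℕ) : ℝ :=
  ∑ i ∈ Finset.Ico j n, f i / ((i : ℝ) + 1)

theorem renyiMatrix_mulVec_eq_renyiSum {n : ℕ} (f : ℕ → ℝ) (j : Fin n) :
    (renyiMatrix n).mulVec (fun i : Fin n => f i) j = renyiSum n f j := by
  have h := Fin.sum_univ_eq_sum_range
    (fun i => if (j : ℕ) ≤ i then f i / ((i : ℝ) + 1) else 0) n
  rw [renyiMatrix_mulVec, renyiSum]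
  refine Eq.trans ?_ (h.trans ?_)
  · simp only [Fin.le_def]
  · rw [← Finset.sum_filter]
    congr 1
    ext i
    simp [and_comm]

theorem renyiSum_eq_add {n : ℕ} (f : ℕ → ℝ) {j : ℕ} (hj : j < n) :
    renyiSum n f j = f j / ((j : ℝ) + 1) + renyiSum n f (j + 1) :=
  Finset.sum_eq_sum_Ico_succ_bot hj _

theorem renyiSum_pos {n : ℕ} {f : ℕ → ℝ} (hf : ∀ i, 0 < f i) {j : ℕ} (hj : j < n) :
    0 < renyiSum n f j :=
  Finset.sum_pos (fun i _ => div_pos (hf i) (by positivity)) ⟨j, by simp [hj]⟩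

theorem renyiSum_antitone {n : ℕ} {f : ℕ → ℝ} (hf : ∀ i, 0 < f i) : Antitone (renyiSum n f) :=
  fun _ _ hab => Finset.sum_le_sum_of_subset_of_nonneg (Finset.Ico_subset_Ico_left hab)
    fun i _ _ => (div_pos (hf i) (by positivity)).le

theorem memLp_renyiSum [IsProbabilityMeasure Q] {f : ℕ → Ω → ℝ}
    (hlaw : ∀ i, HasLaw (f i) (expMeasure 1) Q) (n j : ℕ) :
    MemLp (fun ω => renyiSum n (fun i => f i ω) j) 2 Q := by
  unfold renyiSum
  refine memLp_finsetSum _ fun i _ => ?_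
  simp_rw [div_eq_inv_mul]
  exact (memLp_two_of_hasLaw_exp (hlaw i)).const_mul _

theorem sum_inv_sq_le_two (n : ℕ) :
    ∑ i ∈ Finset.range n, (1 / ((i : ℝ) + 1)) ^ 2 ≤ 2 := by
  suffices h : ∑ i ∈ Finset.range n, (1 / ((i : ℝ) + 1)) ^ 2 ≤ 2 - 1 / (n : ℝ) by
    have : (0 : ℝ) ≤ 1 / (n : ℝ) := by positivity
    linarith
  induction n with
  | zero => simp
  | succ n ih =>
    rw [Finset.sum_range_succ]
    rcases Nat.eq_zero_or_pos n with rfl | hn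
    · norm_num
    have hn' : (0 : ℝ) < n := by exact_mod_cast hn
    have : (1 / ((n : ℝ) + 1)) ^ 2 ≤ 1 / (n : ℝ) - 1 / ((n : ℝ) + 1) := by
      rw [div_sub_div _ _ hn'.ne' (by positivity), div_pow, div_le_div_iff₀ (by positivity)
        (by positivity)]
      nlinarith
    push_cast
    linarith

/-- The variance of a Rényi sum is at most `2`, so that its second moment about any point within
distance `1` of its mean is at most `3`. -/
theorem integral_sq_renyiSum_sub_le [IsProbabilityMeasure Q] {f : ℕ → Ω → ℝ}
    (hlaw : ∀ i, HasLaw (f i) (expMeasure 1) Q) (hindep : iIndepFun f Q) (n j : ℕ) {c : ℝ}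
    (hc : |∑ i ∈ Finset.Ico j n, 1 / ((i : ℝ) + 1) - c| ≤ 1) :
    ∫ ω, (renyiSum n (fun i => f i ω) j - c) ^ 2 ∂Q ≤ 3 := by
  have hmean : ∫ ω, renyiSum n (fun i => f i ω) j ∂Q =
      ∑ i ∈ Finset.Ico j n, 1 / ((i : ℝ) + 1) := by
    unfold renyiSum
    rw [integral_finsetSum _ fun i _ =>
      ((memLp_two_of_hasLaw_exp (hlaw i)).integrable (by norm_num)).div_const _]
    simp_rw [integral_div, integral_of_hasLaw_exp (hlaw _)]
  have hvar : Var[fun ω => renyiSum n (fun i => f i ω) j; Q] ≤ 2 := by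
    have hterm : ∀ i : ℕ, MemLp (fun ω => (1 / ((i : ℝ) + 1)) * f i ω) 2 Q := fun i =>
      (memLp_two_of_hasLaw_exp (hlaw i)).const_mul _
    have heq : (fun ω => renyiSum n (fun i => f i ω) j) =
        ∑ i ∈ Finset.Ico j n, fun ω => (1 / ((i : ℝ) + 1)) * f i ω := by
      ext ω
      simp only [renyiSum, Finset.sum_apply]
      exact Finset.sum_congr rfl fun i _ => by ring
    rw [heq, IndepFun.variance_sum (fun i _ => hterm i)]
    · simp_rw [variance_const_mul, variance_of_hasLaw_exp (hlaw _), mul_one]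
      refine le_trans ?_ (sum_inv_sq_le_two n)
      refine Finset.sum_le_sum_of_subset_of_nonneg ?_ fun i _ _ => by positivity
      intro i hi
      simp only [Finset.mem_Ico, Finset.mem_range] at hi ⊢
      exact hi.2
    · intro a _ b _ hab
      exact (hindep.indepFun hab).comp (φ := fun x => (1 / ((a : ℝ) + 1)) * x)
        (ψ := fun x => (1 / ((b : ℝ) + 1)) * x) (by fun_prop) (by fun_prop)
  rw [integral_sub_sq (memLp_renyiSum hlaw n j), hmean]
  have := (sq_le_one_iff_abs_le_one _).2 hc
  linarith

end Exponential

theorem sum_Ico_one_div_eq_harmonic_sub {j n : ℕ} (hj : j ≤ n) :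
    ∑ i ∈ Finset.Ico j n, 1 / ((i : ℝ) + 1) = harmonic n - harmonic j := by
  rw [Finset.sum_Ico_eq_sub _ hj]
  simp [harmonic]

theorem harmonic_sub_log_mem {n : ℕ} (hn : 1 ≤ n) :
    0 ≤ (harmonic n : ℝ) - Real.log n ∧ (harmonic n : ℝ) - Real.log n ≤ 1 := by
  have h0 : n ≠ 0 := by omega
  have h1 := Real.strictAnti_eulerMascheroniSeq'.antitone hn
  have h2 := Real.eulerMascheroniConstant_lt_eulerMascheroniSeq' n
  have h3 := Real.one_half_lt_eulerMascheroniConstant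
  rw [Real.eulerMascheroniSeq'_one] at h1
  simp only [Real.eulerMascheroniSeq', h0, if_false] at h1 h2
  constructor <;> linarith

theorem abs_sum_Ico_sub_log_le {j n : ℕ} (hj : 1 ≤ j) (hjn : j ≤ n) :
    |∑ i ∈ Finset.Ico j n, 1 / ((i : ℝ) + 1) - Real.log ((n : ℝ) / j)| ≤ 1 := by
  have h1 := harmonic_sub_log_mem hj
  have h2 := harmonic_sub_log_mem (hj.trans hjn)
  have hj' : (j : ℝ) ≠ 0 := by positivity
  have hn' : (n : ℝ) ≠ 0 := by have := hj.trans hjn; positivity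
  rw [sum_Ico_one_div_eq_harmonic_sub hjn, Real.log_div hn' hj', abs_le]
  constructor <;> linarith

theorem abs_sum_range_sub_log_le {n : ℕ} (hn : 1 ≤ n) :
    |∑ i ∈ Finset.Ico 0 n, 1 / ((i : ℝ) + 1) - Real.log n| ≤ 1 := by
  have h2 := harmonic_sub_log_mem hn
  rw [sum_Ico_one_div_eq_harmonic_sub (Nat.zero_le n), harmonic_zero, abs_le]
  push_cast
  constructor <;> linarith

/-! ### The quantile transform -/

section Quantile

variable {μ : Measure ℝ}

theorem le_cumHazard_iff (ht : ∀ x : ℝ, 1 - cdf μ x = Real.exp (-cumHazard μ x)) (y t : ℝ) : y ≤ cumHazard μ t ↔ 1 - Real.exp (-y) ≤ cdf μ t := by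
  have := ht t
  rw [show cdf μ t = 1 - Real.exp (-cumHazard μ t) by linarith, sub_le_sub_iff_left,
    Real.exp_le_exp, neg_le_neg_iff]

theorem cumHazardInv_le_iff (ht : ∀ x : ℝ, 1 - cdf μ x = Real.exp (-cumHazard μ x))
    {y : ℝ} (hy : 0 < y) (t : ℝ) : cumHazardInv μ y ≤ t ↔ y ≤ cumHazard μ t := by
  set S := {t : ℝ | y ≤ cumHazard μ t} with hS
  have hv0 : 0 < 1 - Real.exp (-y) := by
    have : Real.exp (-y) < 1 := Real.exp_lt_one_iff.2 (by linarith)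
    linarith
  have hv1 : 1 - Real.exp (-y) < 1 := by linarith [Real.exp_pos (-y)]
  have hbdd : BddBelow S := by
    obtain ⟨a, ha⟩ := ((tendsto_cdf_atBot μ).eventually (gt_mem_nhds hv0)).exists
    refine ⟨a, fun s hs => ?_⟩
    have hs' := (le_cumHazard_iff ht y s).1 hs
    by_contra hc
    have := monotone_cdf μ (not_le.1 hc).le
    linarith
  have hne : S.Nonempty := by
    obtain ⟨a, ha⟩ := ((tendsto_cdf_atTop μ).eventually (lt_mem_nhds hv1)).exists
    exact ⟨a, (le_cumHazard_iff ht y a).2 (le_of_lt ha)⟩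
  constructor
  · intro h
    rw [le_cumHazard_iff ht]
    -- Right-continuity of the distribution function makes the superlevel set contain its infimum.
    have hc : Tendsto (cdf μ) (𝓝[>] t) (𝓝 (cdf μ t)) :=
      ((cdf μ).right_continuous t).mono Set.Ioi_subset_Ici_self
    refine ge_of_tendsto hc ?_
    filter_upwards [self_mem_nhdsWithin] with s hs
    obtain ⟨u, hu, hus⟩ := exists_lt_of_csInf_lt hne (lt_of_le_of_lt h hs)
    exact ((le_cumHazard_iff ht y u).1 hu).trans (monotone_cdf μ hus.le)
  · intro h
    exact csInf_le hbdd h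

theorem cumHazardInv_mono (ht : ∀ x : ℝ, 1 - cdf μ x = Real.exp (-cumHazard μ x))
    {y y' : ℝ} (hy : 0 < y) (h : y ≤ y') : cumHazardInv μ y ≤ cumHazardInv μ y' :=
  (cumHazardInv_le_iff ht hy _).2
    (h.trans ((cumHazardInv_le_iff ht (hy.trans_le h) _).1 le_rfl))

theorem cumHazard_nonneg (t : ℝ) : 0 ≤ cumHazard μ t := by
  have h0 := cdf_nonneg μ t
  have h1 := cdf_le_one μ t
  have := Real.log_nonpos (x := 1 - cdf μ t) (by linarith) (by linarith)
  unfold cumHazard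
  linarith

/-- For `y ≤ 0` the infimum runs over the whole line and takes the default value `0`. -/
theorem cumHazardInv_of_nonpos {y : ℝ} (hy : y ≤ 0) : cumHazardInv μ y = 0 := by
  have : {t : ℝ | y ≤ cumHazard μ t} = Set.univ :=
    Set.eq_univ_of_forall fun t => hy.trans (cumHazard_nonneg t)
  rw [cumHazardInv, this, Real.sInf_univ]

theorem measurable_cumHazardInv (ht : ∀ x : ℝ, 1 - cdf μ x = Real.exp (-cumHazard μ x)) :
    Measurable (cumHazardInv μ) := by
  refine measurable_of_Iic fun t => ?_
  have : cumHazardInv μ ⁻¹' Set.Iic t =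
      (Set.Iic 0 ∩ {_y : ℝ | 0 ≤ t}) ∪ (Set.Ioi 0 ∩ Set.Iic (cumHazard μ t)) := by
    ext y
    rcases le_or_gt y 0 with hy | hy
    · simp [cumHazardInv_of_nonpos hy, hy, not_lt.2 hy]
    · simp [cumHazardInv_le_iff ht hy, hy, not_le.2 hy]
  rw [this]
  exact (measurableSet_Iic.inter (MeasurableSet.const _)).union
    (measurableSet_Ioi.inter measurableSet_Iic)

theorem map_cumHazardInv_expMeasure [IsProbabilityMeasure μ]
    (ht : ∀ x : ℝ, 1 - cdf μ x = Real.exp (-cumHazard μ x)) :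
    (expMeasure 1).map (cumHazardInv μ) = μ := by
  have := isProbabilityMeasure_expMeasure (r := 1) one_pos
  have hm := measurable_cumHazardInv ht
  have := Measure.isProbabilityMeasure_map (μ := expMeasure 1) hm.aemeasurable
  refine Measure.ext_of_Iic _ _ fun t => ?_
  rw [Measure.map_apply hm measurableSet_Iic]
  have h1 : cumHazardInv μ ⁻¹' Set.Iic t =ᵐ[expMeasure 1] Set.Iic (cumHazard μ t) := by
    rw [Filter.eventuallyEq_set]
    filter_upwards [ae_pos_expMeasure] with y hy
    exact cumHazardInv_le_iff ht hy t
  rw [measure_congr h1, ← ofReal_cdf, ← ofReal_cdf, cdf_expMeasure_eq one_pos,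
    if_pos (cumHazard_nonneg t), one_mul, ← ht t]
  congr 1
  ring

end Quantile

/-! ### Consequences of the second-order condition -/

theorem K_sub_bounds {ρ a c : ℝ} (hρ : ρ < 0) (ha : 1 ≤ a) (hac : a ≤ c) :
    c ^ (ρ - 1) * (c - a) ≤ K ρ c - K ρ a ∧ K ρ c - K ρ a ≤ c - a := by
  have hcont : ∀ u v : ℝ, 1 ≤ u → 1 ≤ v → IntervalIntegrable (fun t : ℝ => t ^ (ρ - 1)) volume u v := by
    intro u v hu hv
    refine ContinuousOn.intervalIntegrable fun t ht => ?_
    have : 0 < t := lt_of_lt_of_le (lt_min (by linarith) (by linarith)) ht.1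
    exact (Real.continuousAt_rpow_const t _ (Or.inl this.ne')).continuousWithinAt
  have h1 : K ρ c - K ρ a = ∫ t in a..c, t ^ (ρ - 1) := by
    rw [K, K, intervalIntegral.integral_interval_sub_left (hcont _ _ le_rfl (ha.trans hac))
      (hcont _ _ le_rfl ha)]
  rw [h1]
  constructor
  · have := intervalIntegral.integral_mono_on (f := fun _ => c ^ (ρ - 1)) hac (by simp)
      (hcont a c ha (ha.trans hac)) (fun t ht => Real.rpow_le_rpow_of_nonpos
        (by linarith [ht.1]) ht.2 (by linarith))
    simpa [mul_comm] using this
  · have := intervalIntegral.integral_mono_on (g := fun _ => (1 : ℝ)) hac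
      (hcont a c ha (ha.trans hac)) (by simp)
      (fun t ht => Real.rpow_le_one_of_one_le_of_nonpos (by linarith [ht.1]) (by linarith))
    simpa using this

theorem K_one (ρ : ℝ) : K ρ 1 = 0 := by simp [K]

theorem K_pos {ρ c : ℝ} (hρ : ρ < 0) (hc : 1 < c) : 0 < K ρ c := by
  have := (K_sub_bounds hρ le_rfl hc.le).1
  rw [K_one, sub_zero] at this
  exact lt_of_lt_of_le (mul_pos (Real.rpow_pos_of_pos (by linarith) _) (by linarith)) this

/-- The second-order condition, cleared of denominators. -/
theorem SecondOrder.abs_log_sub_le {ℓ b : ℝ → ℝ} {ρ : ℝ} (h : SecondOrder ℓ b ρ)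
    (hℓ : ∀ᶠ x in atTop, 0 < ℓ x) (hb : ∀ᶠ x in atTop, b x ≠ 0)
    {η : ℝ} (hη : 0 < η) {A : ℝ} (hA : 1 < A) :
    ∀ᶠ x in atTop, ∀ y, x ≤ y → y ≤ A * x →
      |Real.log (ℓ y) - Real.log (ℓ x) - b x * K ρ (y / x)| ≤ η * |b x| * K ρ (y / x) := by
  filter_upwards [h.uniform η hη A hA, eventually_forall_ge_atTop.2 hℓ, hb, eventually_gt_atTop 0]
    with x hu hpos hbx hx y hxy hyA
  rcases hxy.eq_or_lt with rfl | hlt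
  · simp [div_self hx.ne', K_one]
  have hc1 : 1 < y / x := (one_lt_div hx).2 hlt
  have hK := K_pos h.rho_neg hc1
  have h1 := hu (y / x) ⟨hc1, (div_le_iff₀ hx).2 hyA⟩
  rw [div_mul_cancel₀ _ hx.ne', Real.log_div (hpos y hxy).ne' (hpos x le_rfl).ne'] at h1
  have hne : b x * K ρ (y / x) ≠ 0 := mul_ne_zero hbx hK.ne'
  have h2 : Real.log (ℓ y) - Real.log (ℓ x) - b x * K ρ (y / x) =
      ((Real.log (ℓ y) - Real.log (ℓ x)) / (b x * K ρ (y / x)) - 1) * (b x * K ρ (y / x)) := by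
    field_simp
  rw [h2, abs_mul, abs_mul (b x), abs_of_pos hK, mul_assoc]
  gcongr

/-- The auxiliary function varies slowly under small relative perturbations to the right; this
comes from the cocycle identity `log (ℓ (2y) / ℓ x) = log (ℓ y / ℓ x) + log (ℓ (2y) / ℓ y)`. -/
theorem SecondOrder.abs_sub_le_of_le {ℓ b : ℝ → ℝ} {ρ : ℝ} (h : SecondOrder ℓ b ρ)
    (hℓ : ∀ᶠ x in atTop, 0 < ℓ x) (hb : ∀ᶠ x in atTop, b x ≠ 0) {ε : ℝ} (hε : 0 < ε) :
    ∃ δ > 0, ∀ᶠ x in atTop, ∀ y, x ≤ y → y ≤ (1 + δ) * x → |b y - b x| ≤ ε * |b x| := by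
  set κ := K ρ 2 with hκ
  have hκ0 : 0 < κ := K_pos h.rho_neg one_lt_two
  have hκ1 : κ ≤ 1 := by
    have := (K_sub_bounds h.rho_neg (le_refl 1) one_le_two).2
    rw [K_one] at this
    linarith
  set η := min (1 / 2) (ε * κ / 14) with hη
  have hη0 : 0 < η := lt_min (by norm_num) (by positivity)
  have hη1 : η ≤ 1 / 2 := min_le_left _ _
  have hη2 : 14 * η ≤ ε * κ := by have := min_le_right (1 / 2) (ε * κ / 14); linarith
  refine ⟨η, hη0, ?_⟩
  filter_upwards [eventually_forall_ge_atTop.2 (h.abs_log_sub_le hℓ hb hη0 (A := 4) (by norm_num)),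
    eventually_gt_atTop 0] with x hx hx0 y hxy hyx
  have hy0 : 0 < y := hx0.trans_le hxy
  have hc1 : 1 ≤ y / x := (one_le_div hx0).2 hxy
  have hc2 : y / x ≤ 1 + η := (div_le_iff₀ hx0).2 hyx
  have h1 := hx x le_rfl y hxy (by nlinarith)
  have h2 := hx x le_rfl (2 * y) (by linarith) (by nlinarith)
  have h3 := hx y hxy (2 * y) (by linarith) (by linarith)
  rw [mul_div_assoc, div_self hy0.ne', mul_one, ← hκ] at h3
  rw [mul_div_assoc] at h2
  set c := y / x with hc
  have k1 := K_sub_bounds h.rho_neg (le_refl 1) hc1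
  have k2 := K_sub_bounds h.rho_neg (le_refl 1) (show (1 : ℝ) ≤ 2 * c by linarith)
  have k3 := K_sub_bounds h.rho_neg (show (1 : ℝ) ≤ 2 by norm_num) (show (2 : ℝ) ≤ 2 * c by linarith)
  rw [K_one, sub_zero] at k1 k2
  rw [← hκ] at k3
  have k1' : 0 ≤ K ρ c := le_trans (mul_nonneg (by positivity) (by linarith)) k1.1
  have k3' : 0 ≤ K ρ (2 * c) - κ :=
    le_trans (mul_nonneg (by positivity) (by linarith)) k3.1
  have hA := abs_nonneg (b x)
  have e1 : |Real.log (ℓ y) - Real.log (ℓ x) - b x * K ρ c| ≤ η * |b x| * 1 :=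
    h1.trans (mul_le_mul_of_nonneg_left (by linarith) (by positivity))
  have e2 : |Real.log (ℓ (2 * y)) - Real.log (ℓ x) - b x * K ρ (2 * c)| ≤ η * |b x| * 3 :=
    h2.trans (mul_le_mul_of_nonneg_left (by linarith) (by positivity))
  have e4 : |K ρ (2 * c) - κ - K ρ c| ≤ 2 * η := by
    rw [abs_le]; constructor <;> linarith
  have e5 : |b x * (K ρ (2 * c) - κ - K ρ c)| ≤ |b x| * (2 * η) := by
    rw [abs_mul]; gcongr
  have e6 : |b y| ≤ |b x| + |b y - b x| := by
    have := abs_add_le (b x) (b y - b x)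
    simpa using this
  have e7 : η * |b y| * κ ≤ η * |b x| + 1 / 2 * (|b y - b x| * κ) := by
    have t1 : η * |b y| * κ ≤ η * (|b x| + |b y - b x|) * κ := by gcongr
    have t2 : η * |b x| * κ ≤ η * |b x| * 1 := by gcongr
    have t3 : η * (|b y - b x| * κ) ≤ 1 / 2 * (|b y - b x| * κ) := by gcongr
    nlinarith
  -- Subtracting `e1` and `h3` from `e2` cancels `log ℓ` and leaves `b y κ - b x (K(2c) - K(c))`.
  have e8 : |b y - b x| * κ ≤ η * |b y| * κ + η * |b x| * 3 + η * |b x| * 1 + |b x| * (2 * η) := by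
    rw [← abs_of_pos hκ0, ← abs_mul, abs_of_pos hκ0]
    rw [abs_le] at e1 e2 h3 e5 ⊢
    constructor <;> nlinarith
  have e9 : |b y - b x| * κ ≤ ε * |b x| * κ := by
    have : 14 * η * |b x| ≤ ε * κ * |b x| := by gcongr
    linarith
  exact le_of_mul_le_mul_right e9 hκ0

theorem SecondOrder.abs_sub_le {ℓ b : ℝ → ℝ} {ρ : ℝ} (h : SecondOrder ℓ b ρ)
    (hℓ : ∀ᶠ x in atTop, 0 < ℓ x) (hb : ∀ᶠ x in atTop, b x ≠ 0) {ε : ℝ} (hε : 0 < ε) :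
    ∃ δ > 0, ∀ᶠ L in atTop, ∀ x, |x - L| ≤ δ * L → |b x - b L| ≤ ε * |b L| := by
  have hε1 : 0 < min (1 / 2) (ε / 2) := lt_min (by norm_num) (by linarith)
  obtain ⟨δ, hδ, hev⟩ := h.abs_sub_le_of_le hℓ hb hε1
  set ε₁ := min (1 / 2) (ε / 2) with hε₁
  have hle : ε₁ ≤ 1 / 2 := min_le_left _ _
  have hle' : ε₁ ≤ ε / 2 := min_le_right _ _
  obtain ⟨X, hX⟩ := eventually_atTop.1 hev
  refine ⟨min (1 / 2) (δ / 2), lt_min (by norm_num) (by linarith), ?_⟩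
  have hd1 : min (1 / 2) (δ / 2) ≤ 1 / 2 := min_le_left _ _
  have hd2 : min (1 / 2) (δ / 2) ≤ δ / 2 := min_le_right _ _
  filter_upwards [eventually_gt_atTop 0, eventually_ge_atTop X, eventually_ge_atTop (2 * X)]
    with L hL0 hLX hL2X x hx
  rw [abs_le] at hx
  have m1 := mul_le_mul_of_nonneg_right hd1 hL0.le
  have m2 := mul_le_mul_of_nonneg_right hd2 hL0.le
  rcases le_total L x with hLx | hxL
  · have := hX L hLX x hLx (by nlinarith)
    refine this.trans ?_
    gcongr
    linarith
  -- For `x ≤ L` the bound to the right of `x` is used, with the roles of `x` and `L` exchanged.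
  · have hxh : L / 2 ≤ x := by linarith
    have h1 := hX x (by linarith) L hxL (by nlinarith)
    have h2 : |b x| ≤ |b L| + |b L - b x| := by
      have := abs_sub_abs_le_abs_sub (b x) (b L)
      rw [abs_sub_comm] at this
      linarith
    rw [abs_sub_comm]
    have h3 : ε₁ * |b x| ≤ ε₁ * (|b L| + |b L - b x|) := by gcongr
    have h4 : ε₁ * |b L - b x| ≤ 1 / 2 * |b L - b x| := by gcongr
    have h5 : ε₁ * |b L| ≤ ε / 2 * |b L| := by gcongr
    linarith

theorem exists_rpow_ge_one_sub (s : ℝ) {η : ℝ} (hη : 0 < η) :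
    ∃ δ > 0, ∀ c : ℝ, 1 ≤ c → c ≤ 1 + δ → 1 - η ≤ c ^ s := by
  have hc : Tendsto (fun c : ℝ => c ^ s) (𝓝 1) (𝓝 1) := by
    simpa using (Real.continuousAt_rpow_const 1 s (Or.inl one_ne_zero)).tendsto
  obtain ⟨δ, hδ, hδ'⟩ := Metric.eventually_nhds_iff.1
    (hc.eventually (lt_mem_nhds (show 1 - η < 1 by linarith)))
  refine ⟨δ / 2, by linarith, fun c h1 h2 => (hδ' ?_).le⟩
  rw [Real.dist_eq, abs_lt]
  constructor <;> linarith

/-- Linearized second-order condition: between points close to `L` on a relative scale, `log ℓ`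
increases like `b L · (y - x) / L`. -/
theorem SecondOrder.abs_log_sub_linear_le {ℓ b : ℝ → ℝ} {ρ : ℝ} (h : SecondOrder ℓ b ρ)
    (hℓ : ∀ᶠ x in atTop, 0 < ℓ x) (hb : ∀ᶠ x in atTop, b x ≠ 0) {ε : ℝ} (hε : 0 < ε) :
    ∃ δ > 0, ∀ᶠ L in atTop, ∀ x y, |x - L| ≤ δ * L → |y - L| ≤ δ * L → x ≤ y →
      |Real.log (ℓ y) - Real.log (ℓ x) - b L * ((y - x) / L)| ≤ ε * |b L| * ((y - x) / L) := by
  set η := min 1 (ε / 11) with hη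
  have hη0 : 0 < η := lt_min one_pos (by positivity)
  have hη1 : η ≤ 1 := min_le_left _ _
  have hη2 : 11 * η ≤ ε := by have := min_le_right 1 (ε / 11); linarith
  obtain ⟨δ₁, hδ₁, hev₁⟩ := h.abs_sub_le hℓ hb hη0
  obtain ⟨δ₂, hδ₂, hpow⟩ := exists_rpow_ge_one_sub (ρ - 1) hη0
  obtain ⟨X, hX⟩ := eventually_atTop.1 (h.abs_log_sub_le hℓ hb hη0 (A := 3) (by norm_num))
  set δ := min (min (1 / 2) (η / 2)) (min δ₁ (δ₂ / 4)) with hδ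
  have d1 : δ ≤ 1 / 2 := (min_le_left _ _).trans (min_le_left _ _)
  have d2 : δ ≤ η / 2 := (min_le_left _ _).trans (min_le_right _ _)
  have d3 : δ ≤ δ₁ := (min_le_right _ _).trans (min_le_left _ _)
  have d4 : δ ≤ δ₂ / 4 := (min_le_right _ _).trans (min_le_right _ _)
  have d0 : 0 < δ := lt_min (lt_min (by norm_num) (by linarith)) (lt_min hδ₁ (by linarith))
  refine ⟨δ, d0, ?_⟩
  filter_upwards [hev₁, eventually_gt_atTop 0, eventually_ge_atTop (2 * X)]
    with L hbL hL0 hLX x y hx hy hxy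
  have hbx := hbL x (hx.trans (by gcongr))
  rw [abs_le] at hx hy
  have m1 := mul_le_mul_of_nonneg_right d1 hL0.le
  have hx2 : L / 2 ≤ x := by linarith
  have hx0 : 0 < x := by linarith
  have hyx : y ≤ (1 + 4 * δ) * x := by
    have : (1 + 4 * δ) * ((1 - δ) * L) ≤ (1 + 4 * δ) * x := by
      gcongr
      linarith
    nlinarith [mul_nonneg (mul_nonneg d0.le (sub_nonneg.2 d1)) hL0.le]
  have hD := hX x (by linarith) y hxy (by nlinarith)
  have hc1 : 1 ≤ y / x := (one_le_div hx0).2 hxy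
  have hc2 : y / x ≤ 1 + 4 * δ := (div_le_iff₀ hx0).2 hyx
  have hp := hpow (y / x) hc1 (by linarith)
  have kb := K_sub_bounds h.rho_neg (le_refl 1) hc1
  rw [K_one, sub_zero] at kb
  set v := (y - x) / L with hv
  have hv0 : 0 ≤ v := div_nonneg (by linarith) hL0.le
  set u := y / x - 1 with hu
  have hu0 : 0 ≤ u := by linarith
  have hux : u * x = v * L := by rw [hu, hv]; field_simp
  have huv : |u - v| ≤ η * v := by
    have e : (u - v) * x = v * (L - x) := by linear_combination hux
    have e2 : |u - v| * x ≤ η * v * x := by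
      rw [← abs_of_pos hx0, ← abs_mul, abs_of_pos hx0, e, abs_mul, abs_of_nonneg hv0]
      have : |L - x| ≤ η * x := by
        rw [abs_le]
        have t1 : δ * L ≤ η / 2 * L := by gcongr
        have t2 : η * (L / 2) ≤ η * x := by gcongr
        constructor <;> linarith
      calc v * |L - x| ≤ v * (η * x) := by gcongr
        _ = η * v * x := by ring
    exact le_of_mul_le_mul_right e2 hx0
  have hu2 : u ≤ 2 * v := by
    have := (abs_le.1 huv).2
    have : η * v ≤ 1 * v := by gcongr
    linarith
  set κ := K ρ (y / x) with hκ
  have hκ0 : 0 ≤ κ := le_trans (mul_nonneg (by positivity) hu0) kb.1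
  have hκu : |κ - u| ≤ η * (2 * v) := by
    have t : (1 - η) * u ≤ (y / x) ^ (ρ - 1) * u := by gcongr
    have t2 : η * u ≤ η * (2 * v) := by gcongr
    rw [abs_le]; constructor <;> linarith [kb.1, kb.2]
  have hbx2 : |b x| ≤ 2 * |b L| := by
    have t := abs_sub_abs_le_abs_sub (b x) (b L)
    have t2 : η * |b L| ≤ 1 * |b L| := by gcongr
    linarith
  have s1 : η * |b x| * κ ≤ η * (2 * |b L|) * (2 * v) := by
    gcongr
    linarith [kb.2]
  have s2 : |b x * (κ - u)| ≤ 2 * |b L| * (η * (2 * v)) := by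
    rw [abs_mul]; gcongr
  have s3 : |(b x - b L) * u| ≤ η * |b L| * (2 * v) := by
    rw [abs_mul, abs_of_nonneg hu0]; gcongr
  have s4 : |b L * (u - v)| ≤ |b L| * (η * v) := by
    rw [abs_mul]; gcongr
  have s5 : 11 * η * (|b L| * v) ≤ ε * (|b L| * v) := by gcongr
  -- Replace `b x K(y / x)` by `b L v` by way of `b x u` and `b L u`.
  have e : Real.log (ℓ y) - Real.log (ℓ x) - b L * v =
      (Real.log (ℓ y) - Real.log (ℓ x) - b x * κ) + b x * (κ - u) + (b x - b L) * u
        + b L * (u - v) := by ring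
  rw [e]
  refine (abs_add_le _ _).trans ((add_le_add_left ((abs_add_le _ _).trans
    (add_le_add_left (abs_add_le _ _) _)) _).trans ?_)
  linarith

/-! ### The statistic as a function of the normalized spacings -/

theorem thetaCheck_of_antitone {n k : ℕ} (hk : k < n) {x : ℕ → ℝ}
    (hx : Antitone fun i : Fin n => x i) :
    thetaCheck (fun i : Fin n => x i) k =
      (1 / (k : ℝ)) * ∑ i ∈ Finset.range k, ((i : ℝ) + 1) * Real.log ((n : ℝ) / ((i : ℝ) + 1)) *
        (Real.log (x i) - Real.log (x (i + 1))) := by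
  have hsum : ∀ g : ℕ → ℝ, ∑ j ∈ Finset.Icc 1 k, g j = ∑ i ∈ Finset.range k, g (i + 1) := by
    intro g
    rw [Finset.range_eq_Ico, Finset.sum_Ico_add' g 0 k 1]
    rfl
  rw [thetaCheck, hsum]
  congr 1
  refine Finset.sum_congr rfl fun i hi => ?_
  have hik := Finset.mem_range.1 hi
  have h1 := orderStat_of_antitone hx (show i < n by omega)
  have h2 := orderStat_of_antitone hx (show i + 1 < n by omega)
  rw [logSpacing, show n - (i + 1) + 1 = n - i by omega, h1, h2]
  push_cast
  rfl

theorem abs_log_sub_log_sub_le {x y : ℝ} (hx : 0 < x) (hxy : x ≤ y) :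
    |Real.log y - Real.log x - (y - x) / x| ≤ ((y - x) / x) ^ 2 := by
  have hy : 0 < y := hx.trans_le hxy
  rw [← Real.log_div hy.ne' hx.ne']
  set u := (y - x) / x with hu
  have hu0 : 0 ≤ u := div_nonneg (by linarith) hx.le
  have hyx : y / x = 1 + u := by rw [hu]; field_simp; ring
  rw [hyx]
  have h1 := Real.log_le_sub_one_of_pos (show 0 < 1 + u by linarith)
  have h2 := Real.one_sub_inv_le_log_of_pos (show 0 < 1 + u by linarith)
  have h3 : u - u ^ 2 ≤ 1 - (1 + u)⁻¹ := by
    have : 1 - (1 + u)⁻¹ = u / (1 + u) := by field_simp; ring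
    rw [this, le_div_iff₀ (by linarith)]
    nlinarith [pow_nonneg hu0 3]
  rw [abs_le]
  constructor <;> linarith [sq_nonneg u]

/-- A single log-spacing, with `x` and `x + F / j` consecutive exponential order statistics, `l`
standing for `log (n / j)` and `D` for the increment of `log ℓ`, is `θ F + B F` up to an error
that is quadratic and of relative order `1 / L`, plus a small multiple of `|B| F`. -/
theorem abs_logSpacing_sub_le {L θ δ ε B D j F x l : ℝ} (hL : 0 < L) (hθ : 0 ≤ θ)
    (hδ : δ ≤ 1 / 2) (hε : 0 ≤ ε) (hj : 1 ≤ j) (hF : 0 ≤ F) (hx : |x - L| ≤ δ * L)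
    (hl1 : L ≤ l) (hl2 : l ≤ (1 + δ) * L)
    (hD : |D - B * (F / j / L)| ≤ ε * |B| * (F / j / L)) :
    |j * l * (θ * (Real.log (x + F / j) - Real.log x) + D) - θ * F - B * F| ≤
      9 * θ / L * (F ^ 2 + (x - l) ^ 2) + |B| * F * (2 * ε + δ) := by
  have hj0 : 0 < j := by linarith
  have hm := mul_le_mul_of_nonneg_right hδ hL.le
  have hxL : L / 2 ≤ x := by linarith [(abs_le.1 hx).1]
  have hx0 : 0 < x := by linarith
  have hl0 : 0 < l := by linarith
  have hl3 : l ≤ 2 * L := by linarith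
  have hlog := abs_log_sub_log_sub_le hx0 (show x ≤ x + F / j by
    have : 0 ≤ F / j := by positivity
    linarith)
  rw [add_sub_cancel_left] at hlog
  set E := Real.log (x + F / j) - Real.log x - F / j / x with hE
  -- The errors come from linearizing the logarithm, from `l ≠ x`, from linearizing `log ℓ`, and
  -- from `l ≠ L`.
  have e : j * l * (θ * (Real.log (x + F / j) - Real.log x) + D) - θ * F - B * F =
      θ * (j * l * E) + θ * (F * (l - x) / x) + j * l * (D - B * (F / j / L))
        + B * (F * ((l - L) / L)) := by
    rw [hE]
    field_simp
    ring
  have t1 : |θ * (j * l * E)| ≤ θ * (8 * F ^ 2 / L) := by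
    rw [abs_mul, abs_of_nonneg hθ, abs_mul, abs_of_pos (mul_pos hj0 hl0)]
    refine mul_le_mul_of_nonneg_left ?_ hθ
    calc j * l * |E| ≤ j * l * (F / j / x) ^ 2 := by gcongr
      _ = l * F ^ 2 / (j * x ^ 2) := by field_simp
      _ ≤ (2 * L) * F ^ 2 / (1 * (L / 2) ^ 2) := by gcongr
      _ = 8 * F ^ 2 / L := by field_simp; ring
  have t2 : |θ * (F * (l - x) / x)| ≤ θ * ((F ^ 2 + (x - l) ^ 2) / L) := by
    rw [abs_mul, abs_of_nonneg hθ, abs_div, abs_of_pos hx0, abs_mul, abs_of_nonneg hF]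
    refine mul_le_mul_of_nonneg_left ?_ hθ
    calc F * |l - x| / x ≤ F * |l - x| / (L / 2) := by gcongr
      _ = (2 * F * |l - x|) / L := by field_simp
      _ ≤ (F ^ 2 + |l - x| ^ 2) / L := by gcongr; exact two_mul_le_add_sq _ _
      _ = (F ^ 2 + (x - l) ^ 2) / L := by rw [sq_abs]; ring
  have t3 : |j * l * (D - B * (F / j / L))| ≤ |B| * F * (2 * ε) := by
    rw [abs_mul, abs_of_pos (mul_pos hj0 hl0)]
    calc j * l * |D - B * (F / j / L)| ≤ j * l * (ε * |B| * (F / j / L)) := by gcongr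
      _ = |B| * F * (ε * (l / L)) := by field_simp
      _ ≤ |B| * F * (ε * 2) := by
        gcongr
        rw [div_le_iff₀ hL]
        exact hl3
      _ = |B| * F * (2 * ε) := by ring
  have t4 : |B * (F * ((l - L) / L))| ≤ |B| * F * δ := by
    rw [abs_mul, abs_mul, abs_of_nonneg hF, mul_assoc,
      abs_of_nonneg (div_nonneg (by linarith) hL.le)]
    gcongr
    rw [div_le_iff₀ hL]
    linarith
  rw [e]
  refine (abs_add_le _ _).trans ((add_le_add_left ((abs_add_le _ _).trans
    (add_le_add_left (abs_add_le _ _) _)) _).trans ?_)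
  have : 9 * θ / L * (F ^ 2 + (x - l) ^ 2) =
      θ * (8 * F ^ 2 / L) + θ * ((F ^ 2 + (x - l) ^ 2) / L) + θ * (8 * (x - l) ^ 2 / L) := by
    field_simp
    ring
  have h8 : 0 ≤ θ * (8 * (x - l) ^ 2 / L) := by positivity
  rw [this]
  linarith

/-! ### Growth of the number of upper order statistics -/

theorem tendsto_log_div_atTop {k : ℕ → ℕ} (hk : Tendsto k atTop atTop)
    (hkn : Tendsto (fun n : ℕ => (k n : ℝ) / n) atTop (𝓝 0)) :
    Tendsto (fun n : ℕ => Real.log ((n : ℝ) / k n)) atTop atTop := by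
  refine Real.tendsto_log_atTop.comp ?_
  have h1 : Tendsto (fun n : ℕ => (k n : ℝ) / n) atTop (𝓝[>] 0) := by
    refine tendsto_nhdsWithin_iff.2 ⟨hkn, ?_⟩
    filter_upwards [hk.eventually_ge_atTop 1, eventually_ge_atTop 1] with n h1 h2
    have hk0 : (0 : ℝ) < k n := Nat.cast_pos.2 h1
    have hn0 : (0 : ℝ) < n := Nat.cast_pos.2 h2
    exact div_pos hk0 hn0
  refine (tendsto_inv_nhdsGT_zero.comp h1).congr fun n => ?_
  simp

/-- The condition `x |b x| → ∞` forces `√k = o(log (n / k))`: the number of order statistics is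
at most of squared logarithmic order. -/
theorem tendsto_sqrt_div_log {b : ℝ → ℝ} (hbias : Tendsto (fun x : ℝ => x * |b x|) atTop atTop)
    {k : ℕ → ℕ} (hk : Tendsto k atTop atTop)
    (hkn : Tendsto (fun n : ℕ => (k n : ℝ) / n) atTop (𝓝 0)) {lam : ℝ}
    (hlam : Tendsto (fun n : ℕ => √(k n : ℝ) * b (Real.log ((n : ℝ) / k n))) atTop (𝓝 lam)) :
    Tendsto (fun n : ℕ => √(k n : ℝ) / Real.log ((n : ℝ) / k n)) atTop (𝓝 0) := by
  have hL := tendsto_log_div_atTop hk hkn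
  have h1 := hlam.abs.div_atTop (hbias.comp hL)
  refine h1.congr' ?_
  filter_upwards [hL.eventually_gt_atTop 0, (hbias.comp hL).eventually_gt_atTop 0] with n h1 h2
  simp only [Function.comp_apply] at h2 ⊢
  have hb : |b (Real.log ((n : ℝ) / k n))| ≠ 0 := by
    intro h
    rw [h, mul_zero] at h2
    exact lt_irrefl _ h2
  rw [abs_mul, abs_of_nonneg (Real.sqrt_nonneg _), mul_div_mul_right _ _ hb]

theorem log_natCast_le_two_mul_sqrt {k : ℕ} (hk : 1 ≤ k) : Real.log k ≤ 2 * √(k : ℝ) := by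
  have hk0 : (0 : ℝ) < k := by exact_mod_cast hk
  have := Real.log_le_sub_one_of_pos (Real.sqrt_pos.2 hk0)
  rw [Real.log_sqrt hk0.le] at this
  linarith

/-- Since `log k ≤ 2 √k` is negligible against `L = log (n / k)`, so is `log n - L`. -/
theorem eventually_log_le {k : ℕ → ℕ} (hk : Tendsto k atTop atTop)
    (hkn : Tendsto (fun n : ℕ => (k n : ℝ) / n) atTop (𝓝 0))
    (hsq : Tendsto (fun n : ℕ => √(k n : ℝ) / Real.log ((n : ℝ) / k n)) atTop (𝓝 0))
    {δ : ℝ} (hδ : 0 < δ) :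
    ∀ᶠ n : ℕ in atTop, Real.log n ≤ (1 + δ) * Real.log ((n : ℝ) / k n) := by
  filter_upwards [hsq.eventually (gt_mem_nhds (show 0 < δ / 2 by linarith)),
    (tendsto_log_div_atTop hk hkn).eventually_gt_atTop 0, hk.eventually_ge_atTop 1,
    eventually_ge_atTop 1] with n h1 h2 h3 h4
  have hk0 : (k n : ℝ) ≠ 0 := by positivity
  have hn0 : (n : ℝ) ≠ 0 := by positivity
  have := log_natCast_le_two_mul_sqrt h3
  rw [div_lt_iff₀ h2] at h1
  have h5 := Real.log_div hn0 hk0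
  linarith

theorem eventually_lt_of_div_tendsto_zero {k : ℕ → ℕ}
    (hkn : Tendsto (fun n : ℕ => (k n : ℝ) / n) atTop (𝓝 0)) : ∀ᶠ n in atTop, k n < n := by
  filter_upwards [hkn.eventually (gt_mem_nhds one_pos), eventually_ge_atTop 1] with n h1 h2
  rw [div_lt_one (by exact_mod_cast h2)] at h1
  exact_mod_cast h1

/-! ### Approximation of the statistic on a good event -/

/-- On the event that the extreme order statistics `x_0`, `x_k` are close to `L = log (n / k)`,
that the normalized spacings obey a law of large numbers and that a quadratic remainder is small
compared with `√k L`, the standardized estimator is close to the standardized mean of the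
normalized spacings. -/
theorem exists_abs_statistic_sub_le {μ : Measure ℝ} {θ : ℝ} {ℓ b : ℝ → ℝ} {ρ : ℝ}
    (hmodel : IsWeibullTail μ θ ℓ) (hsecond : SecondOrder ℓ b ρ)
    (hbias : Tendsto (fun x : ℝ => x * |b x|) atTop atTop)
    {k : ℕ → ℕ} (hk : Tendsto k atTop atTop)
    (hkn : Tendsto (fun n : ℕ => (k n : ℝ) / n) atTop (𝓝 0)) {lam : ℝ}
    (hlam : Tendsto (fun n : ℕ => √(k n : ℝ) * b (Real.log ((n : ℝ) / k n))) atTop (𝓝 lam))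
    {ε : ℝ} (hε : 0 < ε) :
    ∃ δ > 0, ∀ᶠ n : ℕ in atTop, ∀ f : ℕ → ℝ, (∀ i, 0 < f i) →
      |renyiSum n f 0 - Real.log ((n : ℝ) / k n)| ≤ δ * Real.log ((n : ℝ) / k n) →
      |renyiSum n f (k n) - Real.log ((n : ℝ) / k n)| ≤ δ * Real.log ((n : ℝ) / k n) →
      |∑ i ∈ Finset.range (k n), f i - k n| ≤ δ * k n →
      ∑ i ∈ Finset.range (k n),
        (f i ^ 2 + (renyiSum n f (i + 1) - Real.log ((n : ℝ) / ((i : ℝ) + 1))) ^ 2) ≤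
          δ * (√(k n : ℝ) * Real.log ((n : ℝ) / k n)) →
      |√(k n : ℝ) * (thetaCheck (fun i : Fin n => cumHazardInv μ (renyiSum n f i)) (k n) - θ
          - biasTerm b ρ n (k n)) -
        θ * ((√(k n : ℝ))⁻¹ * (∑ i ∈ Finset.range (k n), f i - k n))| ≤ ε := by
  have hL := tendsto_log_div_atTop hk hkn
  have hsq := tendsto_sqrt_div_log hbias hk hkn hlam
  have hb0 : ∀ᶠ x in atTop, b x ≠ 0 := by
    filter_upwards [hbias.eventually_gt_atTop 0] with x hx h
    simp [h] at hx
  have hℓ := hmodel.slowlyVarying.1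
  have hθ := hmodel.coeff_pos
  set Λ := |lam| + 1 with hΛ
  have hΛ0 : 0 < Λ := by positivity
  -- The final error is at most `9 θ δ + 8 Λ η` for `δ ≤ η`.
  set η := min (1 / 2) (min (ε / (18 * θ)) (ε / (16 * Λ))) with hη
  have hη0 : 0 < η := lt_min (by norm_num) (lt_min (by positivity) (by positivity))
  have hη1 : 9 * θ * η ≤ ε / 2 := by
    have : η ≤ ε / (18 * θ) := (min_le_right _ _).trans (min_le_left _ _)
    rw [le_div_iff₀ (by positivity)] at this
    linarith
  have hη2 : 8 * Λ * η ≤ ε / 2 := by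
    have : η ≤ ε / (16 * Λ) := (min_le_right _ _).trans (min_le_right _ _)
    rw [le_div_iff₀ (by positivity)] at this
    linarith
  obtain ⟨δ₁, hδ₁, hev⟩ := hsecond.abs_log_sub_linear_le hℓ hb0 hη0
  obtain ⟨δ₂, hδ₂, hpow⟩ := exists_rpow_ge_one_sub ρ hη0
  set δ := min η (min δ₁ δ₂) with hδ
  have hδ0 : 0 < δ := lt_min hη0 (lt_min hδ₁ hδ₂)
  have hδη : δ ≤ η := min_le_left _ _
  have hδh : δ ≤ 1 / 2 := hδη.trans (min_le_left _ _)
  have hδδ₁ : δ ≤ δ₁ := (min_le_right _ _).trans (min_le_left _ _)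
  have hδδ₂ : δ ≤ δ₂ := (min_le_right _ _).trans (min_le_right _ _)
  refine ⟨δ, hδ0, ?_⟩
  obtain ⟨X, hX⟩ := eventually_atTop.1 hℓ
  have hΛev : ∀ᶠ n : ℕ in atTop, √(k n : ℝ) * |b (Real.log ((n : ℝ) / k n))| ≤ Λ := by
    filter_upwards [hlam.abs.eventually (gt_mem_nhds (show |lam| < Λ by linarith))] with n hn
    rw [abs_mul, abs_of_nonneg (Real.sqrt_nonneg _)] at hn
    exact hn.le
  filter_upwards [hL.eventually hev, hL.eventually_gt_atTop 0, hL.eventually_ge_atTop (2 * X),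
    hk.eventually_ge_atTop 1, eventually_lt_of_div_tendsto_zero hkn,
    eventually_log_le hk hkn hsq hδ0, hΛev]
    with n hlin hL0 hLX hk1 hkn' hlogn hΛn f hf hx0 hxk hmean hquad
  set L := Real.log ((n : ℝ) / k n) with hLdef
  set B := b L with hB
  set x := renyiSum n f with hxdef
  have hkpos : (0 : ℝ) < k n := by exact_mod_cast hk1
  have hnpos : (0 : ℝ) < n := hkpos.trans (by exact_mod_cast hkn')
  have hsqpos : 0 < √(k n : ℝ) := Real.sqrt_pos.2 hkpos
  have hanti : Antitone x := renyiSum_antitone hf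
  have hxj : ∀ j ≤ k n, |x j - L| ≤ δ * L := by
    intro j hj
    have h1 := hanti hj
    have h2 := hanti (Nat.zero_le j)
    rw [abs_le] at hx0 hxk ⊢
    constructor <;> linarith
  have hxpos : ∀ j ≤ k n, 0 < x j ∧ X ≤ x j := by
    intro j hj
    have h1 := (abs_le.1 (hxj j hj)).1
    have h2 := mul_le_mul_of_nonneg_right hδh hL0.le
    constructor <;> linarith
  have hlogq : ∀ j ≤ k n, Real.log (cumHazardInv μ (x j)) =
      θ * Real.log (x j) + Real.log (ℓ (x j)) := by
    intro j hj
    obtain ⟨h1, h2⟩ := hxpos j hj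
    rw [hmodel.inverse _ h1, Real.log_mul (Real.rpow_pos_of_pos h1 _).ne' (hX _ h2).ne',
      Real.log_rpow h1]
  have hl : ∀ i < k n, L ≤ Real.log ((n : ℝ) / ((i : ℝ) + 1)) ∧
      Real.log ((n : ℝ) / ((i : ℝ) + 1)) ≤ (1 + δ) * L := by
    intro i hi
    have hi' : (i : ℝ) + 1 ≤ k n := by exact_mod_cast hi
    have hi0 : (0 : ℝ) < (i : ℝ) + 1 := by positivity
    constructor
    · exact Real.log_le_log (by positivity) (by gcongr)
    · refine le_trans (Real.log_le_log (by positivity) ?_) hlogn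
      exact div_le_self hnpos.le (by linarith [Nat.cast_nonneg (α := ℝ) i])
  have htheta := thetaCheck_of_antitone hkn' (x := fun j => cumHazardInv μ (x j))
    (fun a b hab => cumHazardInv_mono hmodel.tail (renyiSum_pos hf b.2) (hanti hab))
  have hbiasT : biasTerm b ρ n (k n) = B * ((1 / (k n : ℝ)) * ∑ i ∈ Finset.range (k n),
      (Real.log ((n : ℝ) / ((i : ℝ) + 1)) / L) ^ ρ) := by
    rw [biasTerm, ← hLdef, ← hB, Finset.range_eq_Ico]
    have := Finset.sum_Ico_add' (fun j : ℕ => (Real.log ((n : ℝ) / j) / L) ^ ρ) 0 (k n) 1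
    push_cast at this
    rw [this]
    rfl
  set Z : ℕ → ℝ := fun i => ((i : ℝ) + 1) * Real.log ((n : ℝ) / ((i : ℝ) + 1)) *
        (Real.log (cumHazardInv μ (x i)) - Real.log (cumHazardInv μ (x (i + 1)))) with hZ
  set w : ℕ → ℝ := fun i => (Real.log ((n : ℝ) / ((i : ℝ) + 1)) / L) ^ ρ with hw
  set T := ∑ i ∈ Finset.range (k n),
        (f i ^ 2 + (x (i + 1) - Real.log ((n : ℝ) / ((i : ℝ) + 1))) ^ 2) with hT
  set S := ∑ i ∈ Finset.range (k n), f i with hS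
  have hZi : ∀ i ∈ Finset.range (k n), |Z i - θ * f i - B * f i| ≤
      9 * θ / L * (f i ^ 2 + (x (i + 1) - Real.log ((n : ℝ) / ((i : ℝ) + 1))) ^ 2) +
        |B| * f i * (2 * η + δ) := by
    intro i hi
    have hik := Finset.mem_range.1 hi
    have hrec : x i = x (i + 1) + f i / ((i : ℝ) + 1) := by
      rw [hxdef, renyiSum_eq_add f (hik.trans hkn'), add_comm]
    have hD := hlin (x (i + 1)) (x i) ((hxj _ hik).trans (by gcongr))
      ((hxj _ hik.le).trans (by gcongr)) (hanti (Nat.le_succ i))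
    rw [show x i - x (i + 1) = f i / ((i : ℝ) + 1) by rw [hrec]; ring] at hD
    have := abs_logSpacing_sub_le (L := L) (θ := θ) (δ := δ) (ε := η) (B := B)
      (j := (i : ℝ) + 1) hL0 hθ.le hδh hη0.le (by linarith [Nat.cast_nonneg (α := ℝ) i])
      (hf i).le (hxj _ hik) (hl i hik).1 (hl i hik).2 hD
    refine le_trans (le_of_eq ?_) this
    rw [← hrec]
    simp only [hZ]
    rw [hlogq i hik.le, hlogq (i + 1) hik]
    congr 1
    ring
  have hsumZ : |∑ i ∈ Finset.range (k n), (Z i - θ * f i - B * f i)| ≤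
      9 * θ / L * T + |B| * S * (2 * η + δ) := by
    refine (Finset.abs_sum_le_sum_abs _ _).trans ((Finset.sum_le_sum hZi).trans (le_of_eq ?_))
    rw [Finset.sum_add_distrib, ← Finset.mul_sum, ← Finset.sum_mul, ← Finset.mul_sum]
  have hsumw : |∑ i ∈ Finset.range (k n), w i - k n| ≤ η * k n := by
    have h1 : ∑ i ∈ Finset.range (k n), w i - k n = ∑ i ∈ Finset.range (k n), (w i - 1) := by
      simp
    rw [h1]
    refine (Finset.abs_sum_le_sum_abs _ _).trans
      ((Finset.sum_le_card_nsmul _ _ η fun i hi => ?_).trans (by simp [mul_comm]))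
    obtain ⟨h1, h2⟩ := hl i (Finset.mem_range.1 hi)
    have c1 : 1 ≤ Real.log ((n : ℝ) / ((i : ℝ) + 1)) / L := (one_le_div hL0).2 h1
    have c2 : Real.log ((n : ℝ) / ((i : ℝ) + 1)) / L ≤ 1 + δ := (div_le_iff₀ hL0).2 h2
    have c3 := hpow _ c1 (by linarith)
    have c4 := Real.rpow_le_one_of_one_le_of_nonpos c1 hsecond.rho_neg.le
    rw [abs_le]
    simp only [hw]
    constructor <;> linarith
  -- The deviation of the spacings from `(θ + B) f i`, the law of large numbers, and the deviation
  -- of the bias weights from `1` make up the whole difference.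
  have hsplit : √(k n : ℝ) * (thetaCheck (fun i : Fin n => cumHazardInv μ (x i)) (k n) - θ
          - biasTerm b ρ n (k n)) - θ * ((√(k n : ℝ))⁻¹ * (S - k n)) =
      (√(k n : ℝ))⁻¹ * (∑ i ∈ Finset.range (k n), (Z i - θ * f i - B * f i) + B * (S - k n)
        - B * (∑ i ∈ Finset.range (k n), w i - k n)) := by
    rw [htheta, hbiasT]
    change √(k n : ℝ) * ((1 / (k n : ℝ)) * ∑ i ∈ Finset.range (k n), Z i - θ
      - B * ((1 / (k n : ℝ)) * ∑ i ∈ Finset.range (k n), w i)) - _ = _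
    rw [Finset.sum_sub_distrib, Finset.sum_sub_distrib, ← Finset.mul_sum, ← Finset.mul_sum, ← hS]
    have hs : √(k n : ℝ) = (√(k n : ℝ))⁻¹ * k n := by
      rw [eq_inv_mul_iff_mul_eq₀ hsqpos.ne', Real.mul_self_sqrt hkpos.le]
    generalize √(k n : ℝ) = s at hs hsqpos ⊢
    have e1 : s * ((1 / (k n : ℝ)) * ∑ i ∈ Finset.range (k n), Z i - θ
      - B * ((1 / (k n : ℝ)) * ∑ i ∈ Finset.range (k n), w i)) =
      s⁻¹ * (∑ i ∈ Finset.range (k n), Z i - θ * k n - B * ∑ i ∈ Finset.range (k n), w i) := by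
      nth_rewrite 1 [hs]
      field_simp
    rw [e1]
    ring
  have hS2 : S ≤ 2 * k n := by
    have := (abs_le.1 hmean).2
    have : δ * (k n : ℝ) ≤ 1 / 2 * k n := by gcongr
    linarith
  have hT2 : 9 * θ / L * T ≤ 9 * θ * δ * √(k n : ℝ) := by
    calc 9 * θ / L * T ≤ 9 * θ / L * (δ * (√(k n : ℝ) * L)) := by gcongr
      _ = 9 * θ * δ * √(k n : ℝ) := by field_simp
  have hmain : |∑ i ∈ Finset.range (k n), (Z i - θ * f i - B * f i) + B * (S - k n)
        - B * (∑ i ∈ Finset.range (k n), w i - k n)| ≤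
      9 * θ * η * √(k n : ℝ) + 8 * η * (|B| * k n) := by
    have a1 : |B * (S - k n)| ≤ |B| * (η * k n) := by
      rw [abs_mul]
      exact mul_le_mul_of_nonneg_left (hmean.trans (by gcongr)) (abs_nonneg _)
    have a2 : |B * (∑ i ∈ Finset.range (k n), w i - k n)| ≤ |B| * (η * k n) := by
      rw [abs_mul]
      gcongr
    have a3 : |B| * S * (2 * η + δ) ≤ |B| * (2 * k n) * (2 * η + η) := by gcongr
    have a4 : 9 * θ * δ * √(k n : ℝ) ≤ 9 * θ * η * √(k n : ℝ) := by gcongr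
    refine (abs_sub _ _).trans ((add_le_add_left (abs_add_le _ _) _).trans ?_)
    linarith
  rw [hsplit, abs_mul, abs_of_pos (inv_pos.2 hsqpos), inv_mul_le_iff₀ hsqpos]
  refine hmain.trans ?_
  have hkk : |B| * (k n : ℝ) ≤ Λ * √(k n : ℝ) := by
    calc |B| * (k n : ℝ) = (√(k n : ℝ) * |B|) * √(k n : ℝ) := by
          rw [mul_comm (√(k n : ℝ)), mul_assoc, Real.mul_self_sqrt hkpos.le]
      _ ≤ Λ * √(k n : ℝ) := by gcongr
  have f1 : 8 * η * (|B| * k n) ≤ 8 * η * (Λ * √(k n : ℝ)) := by gcongr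
  have f2 : 9 * θ * η * √(k n : ℝ) ≤ ε / 2 * √(k n : ℝ) := by gcongr
  have f3 : 8 * Λ * η * √(k n : ℝ) ≤ ε / 2 * √(k n : ℝ) := by gcongr
  linarith

/-! ### Transfer of the law to normalized spacings -/

theorem thetaCheck_comp_perm {n : ℕ} (x : Fin n → ℝ) (σ : Equiv.Perm (Fin n)) (k : ℕ) :
    thetaCheck (x ∘ σ) k = thetaCheck x k := by
  simp only [thetaCheck, logSpacing, orderStat_comp_perm]

theorem measurable_thetaCheck {n : ℕ} (k : ℕ) :
    Measurable (fun x : Fin n → ℝ => thetaCheck x k) := by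
  unfold thetaCheck logSpacing
  refine (Finset.measurable_fun_sum _ fun j _ => ?_).const_mul _
  exact (((measurable_orderStat _).log).sub ((measurable_orderStat _).log)).const_mul _

/-- A symmetric statistic of a sample from `μ` has the same law as the statistic of the quantile
transforms of the Rényi sums of a standard exponential sample. -/
theorem map_symmetric_statistic_eq {Ω Ω' : Type*} [MeasurableSpace Ω] [MeasurableSpace Ω']
    {P : Measure Ω} {Q : Measure Ω'} [IsProbabilityMeasure P]
    {μ : Measure ℝ} [IsProbabilityMeasure μ]
    (ht : ∀ x : ℝ, 1 - cdf μ x = Real.exp (-cumHazard μ x))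
    {X : ℕ → Ω → ℝ} (hlaw : ∀ i, HasLaw (X i) μ P) (hindep : iIndepFun X P)
    {f : ℕ → Ω' → ℝ} (hlawf : ∀ i, HasLaw (f i) (expMeasure 1) Q) (hindepf : iIndepFun f Q)
    {n : ℕ} {G : (Fin n → ℝ) → ℝ} (hG : Measurable G)
    (hsymm : ∀ (y : Fin n → ℝ) (σ : Equiv.Perm (Fin n)), G (y ∘ σ) = G y) :
    P.map (fun ω => G fun i : Fin n => X i ω) =
      Q.map (fun ω => G fun i : Fin n => cumHazardInv μ (renyiSum n (fun i => f i ω) i)) := by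
  have := isProbabilityMeasure_expMeasure (r := 1) one_pos
  have hq := measurable_cumHazardInv ht
  have hX : HasLaw (fun ω (i : Fin n) => X i ω) (Measure.pi fun _ => μ) P :=
    iIndepFun.hasLaw_pi (fun i : Fin n => hlaw i) (hindep.precomp Fin.val_injective)
  have hf : HasLaw (fun ω (i : Fin n) => f i ω) (Measure.pi fun _ => expMeasure 1) Q :=
    iIndepFun.hasLaw_pi (fun i : Fin n => hlawf i) (hindepf.precomp Fin.val_injective)
  have hpi : (Measure.pi fun _ : Fin n => expMeasure 1).map
      (fun e i => cumHazardInv μ (e i)) = Measure.pi fun _ : Fin n => μ := by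
    have : ∀ _ : Fin n, SigmaFinite ((expMeasure 1).map (cumHazardInv μ)) := fun _ => by
      rw [map_cumHazardInv_expMeasure ht]
      infer_instance
    rw [Measure.pi_map_pi fun _ => hq.aemeasurable]
    simp_rw [map_cumHazardInv_expMeasure ht]
  have hqm : Measurable fun (e : Fin n → ℝ) (i : Fin n) => cumHazardInv μ (e i) :=
    measurable_pi_lambda _ fun i => hq.comp (measurable_pi_apply i)
  have hM : Measurable fun e : Fin n → ℝ => (renyiMatrix n).mulVec e :=
    (LinearMap.continuous_of_finiteDimensional (Matrix.toLin' (renyiMatrix n))).measurable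
  have hleft : P.map (fun ω => G fun i : Fin n => X i ω) =
      (Measure.pi fun _ : Fin n => expMeasure 1).map
        (fun e => G fun i => cumHazardInv μ (e i)) := by
    have := AEMeasurable.map_map_of_aemeasurable (g := G) (μ := P) hG.aemeasurable hX.aemeasurable
    rw [hX.map_eq, ← hpi, Measure.map_map hG hqm] at this
    exact this.symm
  have hright : Q.map (fun ω => G fun i : Fin n =>
      cumHazardInv μ (renyiSum n (fun i => f i ω) i)) =
      (Measure.pi fun _ : Fin n => expMeasure 1).map
        (fun e => G fun i => cumHazardInv μ ((renyiMatrix n).mulVec e i)) := by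
    have := AEMeasurable.map_map_of_aemeasurable
      (g := fun e => G fun i => cumHazardInv μ ((renyiMatrix n).mulVec e i)) (μ := Q)
      (hG.comp (hqm.comp hM)).aemeasurable hf.aemeasurable
    rw [hf.map_eq] at this
    rw [this]
    congr 1
    ext ω
    simp only [Function.comp_apply]
    congr 1
    ext i
    rw [renyiMatrix_mulVec_eq_renyiSum (fun i => f i ω)]
  rw [hleft, hright]
  ext s hs
  have hm1 : Measurable fun e : Fin n → ℝ => G fun i => cumHazardInv μ (e i) := hG.comp hqm
  have hm2 : Measurable fun e : Fin n → ℝ =>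
      G fun i => cumHazardInv μ ((renyiMatrix n).mulVec e i) := hm1.comp hM
  rw [Measure.map_apply hm1 hs, Measure.map_apply hm2 hs,
    ← lintegral_indicator_one (hm1 hs), ← lintegral_indicator_one (hm2 hs)]
  refine lintegral_pi_expMeasure_eq_renyi (measurable_one.indicator (hm1 hs)) fun y σ => ?_
  have : (G fun i => cumHazardInv μ ((y ∘ σ) i)) = G fun i => cumHazardInv μ (y i) :=
    hsymm (fun i => cumHazardInv μ (y i)) σ
  classical
  simp only [Set.indicator_apply, Set.mem_preimage, Pi.one_apply, this]

/-! ### Probability of the good event -/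

section GoodEvent

variable {Ω : Type*} [MeasurableSpace Ω] {Q : Measure Ω} [IsProbabilityMeasure Q]

theorem measureReal_abs_sub_ge_le {Y : Ω → ℝ} (h : MemLp Y 2 Q) {c M t : ℝ}
    (hM : ∫ ω, (Y ω - c) ^ 2 ∂Q ≤ M) (ht : 0 < t) :
    Q.real {ω | t ≤ |Y ω - c|} ≤ M / t ^ 2 := by
  have h1 := mul_meas_ge_le_integral_of_nonneg (μ := Q) (f := fun ω => (Y ω - c) ^ 2)
    (Eventually.of_forall fun ω => sq_nonneg _) ((h.sub (memLp_const c)).integrable_sq) (t ^ 2)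
  have h2 : {ω | t ≤ |Y ω - c|} = {ω | t ^ 2 ≤ (Y ω - c) ^ 2} := by
    ext ω
    simp only [Set.mem_ofPred_eq]
    rw [← sq_abs (Y ω - c), sq_le_sq₀ ht.le (abs_nonneg _)]
  rw [h2, le_div_iff₀ (by positivity), mul_comm]
  exact h1.trans hM

theorem integral_sq_sum_sub_of_hasLaw_exp {f : ℕ → Ω → ℝ}
    (hlaw : ∀ i, HasLaw (f i) (expMeasure 1) Q) (hindep : iIndepFun f Q) (k : ℕ) :
    ∫ ω, (∑ i ∈ Finset.range k, f i ω - k) ^ 2 ∂Q = k := by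
  have hmem : MemLp (fun ω => ∑ i ∈ Finset.range k, f i ω) 2 Q :=
    memLp_finsetSum _ fun i _ => memLp_two_of_hasLaw_exp (hlaw i)
  have hvar : Var[fun ω => ∑ i ∈ Finset.range k, f i ω; Q] = k := by
    have := IndepFun.variance_sum (μ := Q) (X := f) (s := Finset.range k)
      (fun i _ => memLp_two_of_hasLaw_exp (hlaw i)) (fun a _ b _ hab => hindep.indepFun hab)
    simp_rw [variance_of_hasLaw_exp (hlaw _)] at this
    simpa [Finset.sum_fn] using this
  have hmean : ∫ ω, ∑ i ∈ Finset.range k, f i ω ∂Q = k := by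
    rw [integral_finsetSum _ fun i _ =>
      (memLp_two_of_hasLaw_exp (hlaw i)).integrable (by norm_num)]
    simp [integral_of_hasLaw_exp (hlaw _)]
  rw [integral_sub_sq hmem, hvar, hmean]
  simp

/-- The quadratic remainder has expectation at most `5 k`. -/
theorem measureReal_quadratic_ge_le {f : ℕ → Ω → ℝ}
    (hlaw : ∀ i, HasLaw (f i) (expMeasure 1) Q) (hindep : iIndepFun f Q) {n k : ℕ} (hk : k < n)
    {t : ℝ} (ht : 0 < t) :
    Q.real {ω | t ≤ ∑ i ∈ Finset.range k, (f i ω ^ 2 +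
      (renyiSum n (fun i => f i ω) (i + 1) - Real.log ((n : ℝ) / ((i : ℝ) + 1))) ^ 2)} ≤
      5 * k / t := by
  have hint1 : ∀ i, Integrable (fun ω => f i ω ^ 2) Q := fun i =>
    integrable_pow_of_hasLaw_exp (hlaw i) 2
  have hint2 : ∀ i : ℕ, Integrable (fun ω => (renyiSum n (fun i => f i ω) (i + 1) -
      Real.log ((n : ℝ) / ((i : ℝ) + 1))) ^ 2) Q := fun i =>
    ((memLp_renyiSum hlaw n (i + 1)).sub (memLp_const _)).integrable_sq
  have hint : ∀ i : ℕ, Integrable (fun ω => f i ω ^ 2 + (renyiSum n (fun i => f i ω) (i + 1) -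
      Real.log ((n : ℝ) / ((i : ℝ) + 1))) ^ 2) Q := fun i => (hint1 i).add (hint2 i)
  have h1 := mul_meas_ge_le_integral_of_nonneg (μ := Q)
    (f := fun ω => ∑ i ∈ Finset.range k, (f i ω ^ 2 +
      (renyiSum n (fun i => f i ω) (i + 1) - Real.log ((n : ℝ) / ((i : ℝ) + 1))) ^ 2))
    (Eventually.of_forall fun ω => Finset.sum_nonneg fun i _ => by positivity)
    (integrable_finsetSum _ fun i _ => hint i) t
  rw [integral_finsetSum _ fun i _ => hint i] at h1
  rw [le_div_iff₀ ht, mul_comm]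
  refine h1.trans ?_
  have h2 : ∀ i ∈ Finset.range k, ∫ ω, (f i ω ^ 2 +
      (renyiSum n (fun i => f i ω) (i + 1) - Real.log ((n : ℝ) / ((i : ℝ) + 1))) ^ 2) ∂Q ≤ 5 := by
    intro i hi
    have hik := Finset.mem_range.1 hi
    rw [integral_add (hint1 i) (hint2 i), integral_pow_of_hasLaw_exp (hlaw i)]
    have hc := abs_sum_Ico_sub_log_le (j := i + 1) (n := n) (by omega) (by omega)
    push_cast at hc
    have := integral_sq_renyiSum_sub_le hlaw hindep n (i + 1) hc
    norm_num [Nat.factorial]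
    linarith
  refine (Finset.sum_le_card_nsmul _ _ 5 h2).trans (le_of_eq ?_)
  simp [mul_comm]

end GoodEvent

/-! ### Asymptotic normality -/

theorem tendstoInDistribution_scaled_exp_sum {Ω : Type*} [MeasurableSpace Ω] {Q : Measure Ω}
    [IsProbabilityMeasure Q] {f : ℕ → Ω → ℝ} (hlaw : ∀ i, HasLaw (f i) (expMeasure 1) Q)
    (hindep : iIndepFun f Q) (θ : ℝ) :
    TendstoInDistribution
      (fun (m : ℕ) ω => θ * ((√(m : ℝ))⁻¹ * (∑ i ∈ Finset.range m, f i ω - m))) atTop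
      (id : ℝ → ℝ) (fun _ => Q) (gaussianReal 0 (θ ^ 2).toNNReal) := by
  have hvar : Var[fun ω => θ * f 0 ω; Q] = θ ^ 2 := by
    rw [variance_const_mul, variance_of_hasLaw_exp (hlaw 0), mul_one]
  have hmean : ∫ ω, θ * f 0 ω ∂Q = θ := by
    rw [integral_const_mul, integral_of_hasLaw_exp (hlaw 0), mul_one]
  have h := tendstoInDistribution_inv_sqrt_mul_sum_sub (P := Q) (X := fun i ω => θ * f i ω)
    (P' := gaussianReal 0 (θ ^ 2).toNNReal) (Y := id)
    (by rw [hvar]; exact HasLaw.id) ((memLp_two_of_hasLaw_exp (hlaw 0)).const_mul θ)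
    (hindep.comp (fun _ x => θ * x) fun _ => by fun_prop)
    (fun i => ((hlaw i).identDistrib (hlaw 0)).comp (u := fun x => θ * x) (by fun_prop))
  rw [hmean] at h
  refine h.congr (fun m => Eventually.of_forall fun ω => ?_) (Eventually.of_forall fun _ => rfl)
  simp only [← Finset.mul_sum]
  ring

/-- In probability, the standardized estimator of the quantile-transformed Rényi sums differs
negligibly from the standardized sum of the normalized spacings. -/
theorem tendstoInMeasure_statistic_sub_scaled_exp_sum {Ω : Type*} [MeasurableSpace Ω] {Q : Measure Ω}
    [IsProbabilityMeasure Q] {f : ℕ → Ω → ℝ} (hlaw : ∀ i, HasLaw (f i) (expMeasure 1) Q)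
    (hindep : iIndepFun f Q) {μ : Measure ℝ}
    {θ : ℝ} {ℓ b : ℝ → ℝ} {ρ : ℝ}
    (hmodel : IsWeibullTail μ θ ℓ) (hsecond : SecondOrder ℓ b ρ)
    (hbias : Tendsto (fun x : ℝ => x * |b x|) atTop atTop)
    {k : ℕ → ℕ} (hk : Tendsto k atTop atTop)
    (hkn : Tendsto (fun n : ℕ => (k n : ℝ) / n) atTop (𝓝 0)) {lam : ℝ}
    (hlam : Tendsto (fun n : ℕ => √(k n : ℝ) * b (Real.log ((n : ℝ) / k n))) atTop (𝓝 lam)) :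
    TendstoInMeasure Q ((fun (n : ℕ) ω => √(k n : ℝ) *
        (thetaCheck (fun i : Fin n => cumHazardInv μ (renyiSum n (fun i => f i ω) i)) (k n) - θ
          - biasTerm b ρ n (k n))) -
      fun (n : ℕ) ω => θ * ((√(k n : ℝ))⁻¹ * (∑ i ∈ Finset.range (k n), f i ω - k n)))
      atTop 0 := by
  have hL := tendsto_log_div_atTop hk hkn
  have hsq := tendsto_sqrt_div_log hbias hk hkn hlam
  rw [tendstoInMeasure_iff_measureReal_norm]
  intro ε hε
  obtain ⟨δ, hδ, hev⟩ := exists_abs_statistic_sub_le hmodel hsecond hbias hk hkn hlam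
    (show 0 < ε / 2 by linarith)
  set L : ℕ → ℝ := fun n => Real.log ((n : ℝ) / k n) with hLdef
  have hae : Q.real {ω | ¬ ∀ i, 0 < f i ω} = 0 := by
    have : ∀ᵐ ω ∂Q, ∀ i, 0 < f i ω := ae_all_iff.2 fun i =>
      ((hlaw i).ae_iff (p := fun x => 0 < x) (measurableSet_setOfPred.1 measurableSet_Ioi)).2
        ae_pos_expMeasure
    rw [measureReal_def, ae_iff.1 this, ENNReal.toReal_zero]
  -- The five terms are the probabilities that some spacing is not positive, that `x_0` or `x_k`
  -- is far from `L`, that the law of large numbers fails, and that the quadratic remainder is large.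
  have hbound : ∀ᶠ n : ℕ in atTop, Q.real {ω | ε ≤ ‖((fun (n : ℕ) ω => √(k n : ℝ) *
        (thetaCheck (fun i : Fin n => cumHazardInv μ (renyiSum n (fun i => f i ω) i)) (k n) - θ
          - biasTerm b ρ n (k n))) -
      fun (n : ℕ) ω => θ * ((√(k n : ℝ))⁻¹ * (∑ i ∈ Finset.range (k n), f i ω - k n))) n ω -
        (0 : Ω → ℝ) ω‖} ≤
      0 + 3 / (δ / 2 * L n) ^ 2 + 3 / (δ * L n) ^ 2 + (1 / δ ^ 2) / k n +
        5 / δ * (√(k n : ℝ) / L n) := by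
    filter_upwards [hev, hL.eventually_gt_atTop 0, hk.eventually_ge_atTop 1,
      eventually_lt_of_div_tendsto_zero hkn,
      eventually_log_le hk hkn hsq (show 0 < δ / 2 by linarith)] with n hn hL0 hk1 hkn' hlog
    have hkpos : (0 : ℝ) < k n := by exact_mod_cast hk1
    have hspos : 0 < √(k n : ℝ) := Real.sqrt_pos.2 hkpos
    have hLlog : L n ≤ Real.log n := by
      have hnpos : (0 : ℝ) < n := hkpos.trans (by exact_mod_cast hkn')
      refine Real.log_le_log (by positivity) (div_le_self hnpos.le ?_)
      exact_mod_cast hk1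
    -- `x_0` concentrates at `log n`, which is within `δ / 2 * L` of `L`.
    have p1 : Q.real {ω | δ / 2 * L n ≤ |renyiSum n (fun i => f i ω) 0 - Real.log n|} ≤
        3 / (δ / 2 * L n) ^ 2 :=
      measureReal_abs_sub_ge_le (memLp_renyiSum hlaw n 0)
        (integral_sq_renyiSum_sub_le hlaw hindep n 0 (abs_sum_range_sub_log_le (by omega)))
        (by positivity)
    have p2 : Q.real {ω | δ * L n ≤ |renyiSum n (fun i => f i ω) (k n) - L n|} ≤
        3 / (δ * L n) ^ 2 :=
      measureReal_abs_sub_ge_le (memLp_renyiSum hlaw n (k n))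
        (integral_sq_renyiSum_sub_le hlaw hindep n (k n) (abs_sum_Ico_sub_log_le hk1 hkn'.le))
        (by positivity)
    have p3 : Q.real {ω | δ * k n ≤ |∑ i ∈ Finset.range (k n), f i ω - k n|} ≤
        (1 / δ ^ 2) / k n := by
      refine (measureReal_abs_sub_ge_le (memLp_finsetSum _ fun i _ =>
        memLp_two_of_hasLaw_exp (hlaw i)) (integral_sq_sum_sub_of_hasLaw_exp hlaw hindep (k n)).le
        (by positivity)).trans (le_of_eq ?_)
      field_simp
    have p4 := measureReal_quadratic_ge_le hlaw hindep hkn'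
      (show 0 < δ * (√(k n : ℝ) * L n) by positivity)
    have p4e : 5 * (k n : ℝ) / (δ * (√(k n : ℝ) * L n)) = 5 / δ * (√(k n : ℝ) / L n) := by
      have hs : (k n : ℝ) = √(k n : ℝ) * √(k n : ℝ) := (Real.mul_self_sqrt hkpos.le).symm
      generalize √(k n : ℝ) = s at hs hspos ⊢
      rw [hs]
      field_simp
    rw [p4e] at p4
    refine le_trans ?_ (add_le_add (add_le_add (add_le_add (add_le_add hae.le p1) p2) p3) p4)
    refine (measureReal_mono ?_).trans ((measureReal_union_le _ _).trans
      (add_le_add_left ((measureReal_union_le _ _).trans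
      (add_le_add_left ((measureReal_union_le _ _).trans
      (add_le_add_left (measureReal_union_le _ _) _)) _)) _))
    intro ω hω
    by_contra hc
    simp only [Set.mem_union, Set.mem_ofPred_eq, not_or, not_not, not_le] at hc
    obtain ⟨⟨⟨⟨c0, c1⟩, c2⟩, c3⟩, c4⟩ := hc
    have c1' : |renyiSum n (fun i => f i ω) 0 - L n| ≤ δ * L n := by
      rw [abs_lt] at c1
      rw [abs_le]
      constructor <;> linarith
    have := hn (fun i => f i ω) c0 c1' c2.le c3.le c4.le
    simp only [Set.mem_ofPred_eq, Pi.sub_apply, Pi.zero_apply, sub_zero, Real.norm_eq_abs] at hω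
    linarith
  have hlim : Tendsto (fun n : ℕ => 0 + 3 / (δ / 2 * L n) ^ 2 + 3 / (δ * L n) ^ 2 +
      (1 / δ ^ 2) / k n + 5 / δ * (√(k n : ℝ) / L n)) atTop (𝓝 0) := by
    have q1 : ∀ c : ℝ, 0 < c → Tendsto (fun n => 3 / (c * L n) ^ 2) atTop (𝓝 0) := fun c hc =>
      tendsto_const_nhds.div_atTop
        ((tendsto_pow_atTop two_ne_zero).comp (hL.const_mul_atTop hc))
    have q3 : Tendsto (fun n => (1 / δ ^ 2) / (k n : ℝ)) atTop (𝓝 0) :=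
      tendsto_const_nhds.div_atTop (tendsto_natCast_atTop_atTop.comp hk)
    have := ((((tendsto_const_nhds (x := (0 : ℝ))).add (q1 (δ / 2) (by linarith))).add
      (q1 δ hδ)).add q3).add (hsq.const_mul (5 / δ))
    simpa using this
  exact squeeze_zero' (Eventually.of_forall fun _ => measureReal_nonneg) hbound hlim

end WeibullTail

theorem mainTheorem3 {Ω : Type*} [MeasurableSpace Ω] (P : Measure Ω) [IsProbabilityMeasure P]
    (X : ℕ → Ω → ℝ) (μ : Measure ℝ) (hlaw : ∀ i, HasLaw (X i) μ P) (hindep : iIndepFun X P)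
    (θ : ℝ) (ℓ b : ℝ → ℝ) (ρ : ℝ)
    (hmodel : WeibullTail.IsWeibullTail μ θ ℓ)
    (hsecond : WeibullTail.SecondOrder ℓ b ρ)
    (hbias : Tendsto (fun x : ℝ => x * |b x|) atTop atTop)
    (k : ℕ → ℕ) (hk : Tendsto k atTop atTop)
    (hkn : Tendsto (fun n : ℕ => (k n : ℝ) / n) atTop (𝓝 0))
    (lam : ℝ)
    (hlam : Tendsto (fun n : ℕ => √(k n : ℝ) * b (Real.log ((n : ℝ) / k n))) atTop (𝓝 lam))
    (hlam0 : lam = 0 →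
      Tendsto (fun n : ℕ => Real.log (k n) / Real.log n) atTop (𝓝 0)) :
    TendstoInDistribution
      (fun (n : ℕ) (ω : Ω) => √(k n : ℝ) *
        (WeibullTail.thetaCheck (fun i : Fin n => X i ω) (k n) - θ
          - WeibullTail.biasTerm b ρ n (k n)))
      atTop (id : ℝ → ℝ) (fun _ => P) (gaussianReal 0 (θ ^ 2).toNNReal) := by
  have : IsProbabilityMeasure μ := (hlaw 0).isProbabilityMeasure_iff.1 inferInstance
  have := isProbabilityMeasure_expMeasure (r := 1) one_pos
  obtain ⟨Ω', _, Q, f, hfm, hlawf, hindepf, _⟩ := exists_iid ℕ (expMeasure 1)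
  have hG : ∀ n : ℕ, Measurable fun x : Fin n → ℝ => √(k n : ℝ) *
      (WeibullTail.thetaCheck x (k n) - θ - WeibullTail.biasTerm b ρ n (k n)) := fun n =>
    (((WeibullTail.measurable_thetaCheck (k n)).sub_const _).sub_const _).const_mul _
  have hmeas : ∀ n : ℕ, Measurable fun ω (i : Fin n) =>
      WeibullTail.cumHazardInv μ (WeibullTail.renyiSum n (fun i => f i ω) i) := by
    intro n
    refine measurable_pi_lambda _ fun i =>
      (WeibullTail.measurable_cumHazardInv hmodel.tail).comp ?_
    exact Finset.measurable_fun_sum _ fun j _ => (hfm j).div_const _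
  have hclt := WeibullTail.tendstoInDistribution_scaled_exp_sum hlawf hindepf θ
  have hcltk : TendstoInDistribution (fun (n : ℕ) ω => θ * ((√(k n : ℝ))⁻¹ *
      (∑ i ∈ Finset.range (k n), f i ω - k n))) atTop (id : ℝ → ℝ) (fun _ => Q)
      (gaussianReal 0 (θ ^ 2).toNNReal) :=
    ⟨fun n => hclt.forall_aemeasurable (k n), hclt.aemeasurable_limit, hclt.tendsto.comp hk⟩
  have hstat := tendstoInDistribution_of_tendstoInMeasure_sub _ _ hcltk
    (WeibullTail.tendstoInMeasure_statistic_sub_scaled_exp_sum hlawf hindepf hmodel hsecond hbias hk hkn hlam)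
    fun n => ((hG n).comp (hmeas n)).aemeasurable
  have hXm : ∀ n : ℕ, AEMeasurable (fun ω (i : Fin n) => X i ω) P := fun n =>
    aemeasurable_pi_lambda _ fun i => (hlaw i).aemeasurable
  refine ⟨fun n => (hG n).comp_aemeasurable (hXm n), aemeasurable_id, ?_⟩
  refine hstat.tendsto.congr fun n => Subtype.ext ?_
  refine (WeibullTail.map_symmetric_statistic_eq hmodel.tail hlaw hindep hlawf hindepf (hG n)
    fun y σ => ?_).symm
  simp only [WeibullTail.thetaCheck_comp_perm]
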